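/- Let $\mathcal K(x)=\frac{1-e^{-|x|}}{|x|}$ on $\mathbb R^3$. For measurable $f,g\ge 0$ on $\mathbb R^3$ put $V(f,g)=\int_{\mathbb R^3}\int_{\mathbb R^3}\mathcal K(x-y)f(x)g(y)\,dx\,dy\in[0,\infty]$, and let $\psi_f=\mathcal K*f$ denote the convolution $\psi_f(x)=\int_{\mathbb R^3}\mathcal K(x-y)f(y)\,dy$. Let $D^{1,2}(\mathbb R^3)=\{u\in L^6(\mathbb R^3): |\nabla u|\in L^2(\mathbb R^3)\}$ and $\mathcal A=\{u\in D^{1,2}(\mathbb R^3):\Delta u\in L^2(\mathbb R^3)\}$, where $\nabla$ and $\Delta$ are taken in the sense of distributions. We write $\psi_f\in\mathcal A$ if the integral defining $\psi_f(x)$ converges absolutely for almost every $x$ and the resulting function belongs to $\mathcal A$. (i) Let $f:\mathbb R^3\to\mathbb R$ be measurable with $f\ge 0$ almost everywhere. Then $V(f,f)<\infty$ if and only if $\psi_f\in\mathcal A$. (ii) Let $f:\mathbb R^3\to\mathbb R$ be measurable, with $f^+=\max\{f,0\}$ and $f^-=\max\{-f,0\}$. Then $V(|f|,|f|)<\infty$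 if and only if both $\psi_{f^+}\in\mathcal A$ and $\psi_{f^-}\in\mathcal A$. Moreover, if the equivalent conditions in (i) or those in (ii) hold, then $\psi_f\in\mathcal A$, $f$ is locally integrable, and $\psi_f$ solves $-\Delta\psi+\Delta^2\psi=4\pi f$ weakly, that is, $$\int_{\mathbb R^3}\big(\nabla\psi_f\cdot\nabla\varphi+\Delta\psi_f\,\Delta\varphi\big)\,dx=4\pi\int_{\mathbb R^3}f\varphi\,dx\qquad\text{for all }\varphi\in C_c^\infty(\mathbb R^3);$$ furthermore $\psi_f f$ is integrable and the energy identity $$\int_{\mathbb R^3}\big(|\nabla\psi_f|^2+|\Delta\psi_f|^2\big)\,dx=4\pi\int_{\mathbb R^3}\psi_f f\,dx$$ holds. -/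

import Mathlib

open MeasureTheory
open scoped ENNReal Laplacian Gradient ContDiff

namespace BoppPodolsky

noncomputable section

/-- Three-dimensional Euclidean space. -/
abbrev E3 : Type := EuclideanSpace ℝ (Fin 3)

/-- The Bopp-Podolsky kernel `(1 - exp (-|x|)) / |x|`. (The value at the single point `0` plays no
role, since the kernel is only used under integral signs.) -/
def kernel (x : E3) : ℝ := (1 - Real.exp (-‖x‖)) / ‖x‖

/-- The Bopp-Podolsky energy `V(f, g)` of two nonnegative functions, with values in `[0, ∞]`. -/
def energy (f g : E3 → ℝ≥0∞) : ℝ≥0∞ :=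
  ∫⁻ x, ∫⁻ y, ENNReal.ofReal (kernel (x - y)) * f x * g y

/-- The potential `ψ_f = K * f`, a function on `ℝ³`. -/
def potential (f : E3 → ℝ) (x : E3) : ℝ := ∫ y, kernel (x - y) * f y

/-- Test functions: smooth real functions with compact support. -/
def IsTest (φ : E3 → ℝ) : Prop := ContDiff ℝ ∞ φ ∧ HasCompactSupport φ

/-- `G` is the distributional gradient of the locally integrable function `u`. -/
def HasWeakGradient (u : E3 → ℝ) (G : E3 → E3) : Prop :=
  LocallyIntegrable u ∧ LocallyIntegrable G ∧
    ∀ φ : E3 → ℝ, IsTest φ → ∫ x, u x • ∇ φ x = -∫ x, φ x • G x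

/-- `L` is the distributional Laplacian of the locally integrable function `u`. -/
def HasWeakLaplacian (u L : E3 → ℝ) : Prop :=
  LocallyIntegrable u ∧ LocallyIntegrable L ∧
    ∀ φ : E3 → ℝ, IsTest φ → ∫ x, u x * Δ φ x = ∫ x, φ x * L x

theorem HasWeakGradient.ae_eq {u : E3 → ℝ} {G H : E3 → E3}
    (hG : HasWeakGradient u G) (hH : HasWeakGradient u H) : G =ᵐ[volume] H := by
  refine ae_eq_of_integral_contDiff_smul_eq hG.2.1 hH.2.1 fun φ h1 h2 => ?_
  have h := (hG.2.2 φ ⟨h1, h2⟩).symm.trans (hH.2.2 φ ⟨h1, h2⟩)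
  exact neg_injective h

theorem HasWeakLaplacian.ae_eq {u L M : E3 → ℝ}
    (hL : HasWeakLaplacian u L) (hM : HasWeakLaplacian u M) : L =ᵐ[volume] M := by
  refine ae_eq_of_integral_contDiff_smul_eq hL.2.1 hM.2.1 fun φ h1 h2 => ?_
  exact (hL.2.2 φ ⟨h1, h2⟩).symm.trans (hM.2.2 φ ⟨h1, h2⟩)

open Classical in
/-- The distributional gradient (unique almost everywhere), where it is a function. -/
def weakGradient (u : E3 → ℝ) : E3 → E3 :=
  if h : ∃ G, HasWeakGradient u G then h.choose else 0

open Classical in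
/-- The distributional Laplacian (unique almost everywhere), where it is a function. -/
def weakLaplacian (u : E3 → ℝ) : E3 → ℝ :=
  if h : ∃ L, HasWeakLaplacian u L then h.choose else 0

/-- The space `D^{1,2}(ℝ³)`: functions in `L⁶` with distributional gradient in `L²`. -/
def D12 : Set (E3 → ℝ) :=
  {u | MemLp u 6 ∧ ∃ G, HasWeakGradient u G ∧ MemLp G 2}

/-- The space `𝒜`: functions in `D^{1,2}(ℝ³)` with distributional Laplacian in `L²`. -/
def spaceA : Set (E3 → ℝ) :=
  {u | u ∈ D12 ∧ ∃ L, HasWeakLaplacian u L ∧ MemLp L 2}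

/-- `ψ_f ∈ 𝒜`: the integral defining `ψ_f (x)` converges absolutely for almost every `x`, and the
function so defined lies in `𝒜`. (For measurable `f ≥ 0` the first condition says that the
`[0, ∞]`-valued convolution `K * f` is finite almost everywhere.) -/
def PotentialInA (f : E3 → ℝ) : Prop :=
  (∀ᵐ x, Integrable fun y => kernel (x - y) * f y) ∧ potential f ∈ spaceA

/-- Measurable `f ≥ 0` with `V(f, f) < ∞`. -/
def E1plus : Set (E3 → ℝ) :=
  {f | AEMeasurable f ∧ 0 ≤ᵐ[volume] f ∧
    energy (fun x => ENNReal.ofReal (f x)) (fun x => ENNReal.ofReal (f x)) < ⊤}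

/-- Measurable `f ≥ 0` with `ψ_f ∈ 𝒜`. -/
def E2plus : Set (E3 → ℝ) :=
  {f | AEMeasurable f ∧ 0 ≤ᵐ[volume] f ∧ PotentialInA f}

/-- Measurable `f` with `V(|f|, |f|) < ∞`. -/
def E1 : Set (E3 → ℝ) :=
  {f | AEMeasurable f ∧
    energy (fun x => ENNReal.ofReal |f x|) (fun x => ENNReal.ofReal |f x|) < ⊤}

/-- Measurable `f` such that `ψ_{f⁺}` and `ψ_{f⁻}` belong to `𝒜`. -/
def E2 : Set (E3 → ℝ) :=
  {f | AEMeasurable f ∧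
    PotentialInA (fun x => max (f x) 0) ∧ PotentialInA (fun x => max (-f x) 0)}

/-- `v ∈ 𝒜` solves `-Δ v + Δ² v = 4 π f` in the weak sense (`f` being locally integrable, so that
the right-hand side is meaningful). -/
def IsWeakSolution (f v : E3 → ℝ) : Prop :=
  v ∈ spaceA ∧ LocallyIntegrable f ∧
    ∀ φ : E3 → ℝ, IsTest φ →
      ∫ x, (inner ℝ (weakGradient v x) (∇ φ x) + weakLaplacian v x * Δ φ x) =
        4 * Real.pi * ∫ x, f x * φ x

/-- The energy identity `∫ (|∇ψ_f|² + |Δψ_f|²) = 4 π ∫ ψ_f f`, both integrals being finite. -/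
def EnergyIdentity (f : E3 → ℝ) : Prop :=
  Integrable (fun x => ‖weakGradient (potential f) x‖ ^ 2 + weakLaplacian (potential f) x ^ 2) ∧
  Integrable (fun x => potential f x * f x) ∧
    ∫ x, (‖weakGradient (potential f) x‖ ^ 2 + weakLaplacian (potential f) x ^ 2) =
      4 * Real.pi * ∫ x, potential f x * f x

end

end BoppPodolsky

namespace BoppPodolsky

open Filter Topology Set

/-! ### Polar coordinates and the divergence theorem for radial fields -/

section Polar

/-! Write K for the kernel and Y(x) = exp(-|x|)/|x|. Then ΔK = -Y and -ΔY + Y = 4πδ, so K/(4π) is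
the fundamental solution of -Δ + Δ². Everything rests on the reproducing identity, for x ≠ y, ∫
∇K(z-x)·∇K(z-y) dz + ∫ Y(z-x) Y(z-y) dz = 4π K(x-y), which is `integral_gradK_add_yukawa`.
Integrated against f(x) g(y) it becomes the polarized energy identity `integral_conv_eq_energy`: its
left side pairs ∇ψ_f with ∇ψ_g and Δψ_f with Δψ_g, and its right side is 4π times the energy of (f,
g).

Fubini requires the same bounds with absolute values inside. Since |∇K| ≤ 2/(1+|x|²), the integral
of |∇K(z-x)||∇K(z-y)| is at most C/(1+|x-y|), hence at most C K(x-y); the Y-integral is at most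
4πK(x-y). So finite energy suffices (`IsEnergyKernel.integrable_triple`). The weak derivatives and
the weak equation need less, namely ∫ |f(y)|/(1+|y|) dy < ∞ (`IsAdmissible`), a condition implied by
finite energy and, for measurable f, by absolute convergence of the potential at a single point.

Finite energy implies ψ_f ∈ 𝒜: the identity puts ∇ψ_f and Δψ_f in L². For L⁶ one may take f ≥ 0. The
Sobolev inequality is applied to compactly supported C¹ approximations of ψ_f, whose gradients are
all dominated by one L² function, and Fatou's lemma passes to the limit
(`memLp_six_potential_of_nonneg`).

Conversely let f ≥ 0 and ψ_f ∈ 𝒜, and put A = ∫ (|∇ψ_f|² + |Δψ_f|²). For the truncations f_n,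
positivity of K, the polarized identity and Young's inequality give 4πV(f_n,f_n) ≤ 4πV(f_n,f) ≤
½·4πV(f_n,f_n) + ½A. As V(f_n,f_n) is finite it can be absorbed, so 4πV(f_n,f_n) ≤ A, and Fatou
concludes (`PotentialInA.finiteEnergy`). The signed case follows from |f| = f⁺ + f⁻, because 𝒜 is
closed under addition. -/

theorem finrank_E3 : Module.finrank ℝ E3 = 3 := by simp

theorem toSphere_real_univ_E3 :
    (volume : Measure E3).toSphere.real univ = 4 * Real.pi := by
  rw [Measure.toSphere_real_apply_univ, measureReal_def, EuclideanSpace.volume_ball_fin_three]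
  simp
  rw [ENNReal.toReal_ofReal (by positivity)]
  ring

/-- Integration in polar coordinates, in a form which keeps track of integrability along rays. -/
theorem integral_eq_of_integral_rays {F : E3 → ℝ} (hF : Integrable F) {c : ℝ}
    (h : ∀ θ : Metric.sphere (0 : E3) 1,
      IntegrableOn (fun r : ℝ => r ^ 2 * F (r • (θ : E3))) (Ioi 0) →
      ∫ r in Ioi (0 : ℝ), r ^ 2 * F (r • (θ : E3)) = c) :
    ∫ x, F x = 4 * Real.pi * c := by
  have hmp := (volume : Measure E3).measurePreserving_homeomorphUnitSphereProd
  have hemb := (homeomorphUnitSphereProd E3).measurableEmbedding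
  set P : Metric.sphere (0 : E3) 1 × Ioi (0 : ℝ) → ℝ :=
    fun p => F ((homeomorphUnitSphereProd E3).symm p : E3) with hP
  have hPF : ∀ x : ({(0)}ᶜ : Set E3), P (homeomorphUnitSphereProd E3 x) = F x := by
    intro x; simp only [hP, Homeomorph.symm_apply_apply]
  have hPr : ∀ θ r, P (θ, r) = F ((r : ℝ) • (θ : E3)) := by
    intro θ r; simp [hP, homeomorphUnitSphereProd_symm_apply_coe]
  have hint : Integrable P ((volume : Measure E3).toSphere.prod
      (.volumeIoiPow (Module.finrank ℝ E3 - 1))) := by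
    rw [← hmp.integrable_comp_emb hemb]
    have : Integrable (fun x : ({(0)}ᶜ : Set E3) => F x) (Measure.comap (Subtype.val) volume) := by
      have := (integrableOn_iff_comap_subtypeVal (μ := (volume : Measure E3)) (f := F)
        (measurableSet_singleton (0 : E3)).compl).1 hF.integrableOn
      exact this
    exact this.congr (ae_of_all _ fun x => (hPF x).symm)
  have key : ∫ x, F x = ∫ p, P p ∂((volume : Measure E3).toSphere.prod
      (.volumeIoiPow (Module.finrank ℝ E3 - 1))) := by
    rw [← hmp.integral_comp hemb]
    simp_rw [hPF]
    rw [integral_subtype_comap (measurableSet_singleton _).compl F, restrict_compl_singleton]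
  rw [key, integral_prod _ hint]
  -- By Fubini almost every ray carries an integrable restriction, so the hypothesis on rays may
  -- assume integrability.
  have hae := hint.prod_right_ae
  have hin : ∀ᵐ θ ∂(volume : Measure E3).toSphere,
      ∫ r, P (θ, r) ∂(Measure.volumeIoiPow (Module.finrank ℝ E3 - 1)) = c := by
    filter_upwards [hae] with θ hθ
    simp only [Measure.volumeIoiPow, ENNReal.ofReal, finrank_E3] at hθ ⊢
    have hmeas : Measurable fun r : Ioi (0 : ℝ) => ((r : ℝ) ^ (3 - 1)).toNNReal :=
      (measurable_subtype_coe.pow_const _).real_toNNReal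
    rw [integrable_withDensity_iff_integrable_smul hmeas] at hθ
    rw [integral_withDensity_eq_integral_smul hmeas]
    have e : ∀ r : Ioi (0 : ℝ), (((r : ℝ) ^ (3 - 1)).toNNReal) • P (θ, r)
        = (fun r : ℝ => r ^ 2 * F (r • (θ : E3))) r := by
      intro r
      rw [hPr, NNReal.smul_def, Real.coe_toNNReal _ (pow_nonneg (le_of_lt r.2) _)]; simp
    simp_rw [e] at hθ ⊢
    rw [integral_subtype_comap measurableSet_Ioi fun r : ℝ => r ^ 2 * F (r • (θ : E3))]
    refine h θ ?_
    rw [integrableOn_iff_comap_subtypeVal measurableSet_Ioi]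
    exact hθ
  rw [integral_congr_ae hin, integral_const, toSphere_real_univ_E3, smul_eq_mul]

theorem integrable_radial {f : ℝ → ℝ} (h : IntegrableOn (fun r : ℝ => r ^ 2 * f r) (Ioi 0)) :
    Integrable fun x : E3 => f ‖x‖ := by
  rw [integrable_fun_norm_addHaar, finrank_E3]
  simpa using h

theorem integral_radial (f : ℝ → ℝ) :
    ∫ x : E3, f ‖x‖ = 4 * Real.pi * ∫ r in Ioi (0 : ℝ), r ^ 2 * f r := by
  have h := integral_fun_norm_addHaar (volume : Measure E3) f
  rw [h, ← toSphere_real_univ_E3, Measure.toSphere_real_apply_univ, finrank_E3]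
  simp [mul_assoc]

/-- The radial vector field `b(|x|) x / |x|³`, whose flux through the sphere of radius `r` is
`4 π b(r)`. -/
noncomputable def radialField (b : ℝ → ℝ) (x : E3) : E3 := (b ‖x‖ / ‖x‖ ^ 3) • x

/-- Divergence theorem for a radial field with flux `4 π b(r)`, tested against `Φ`. -/
theorem integral_inner_radialField {b b' : ℝ → ℝ} {C : ℝ} {Φ : E3 → ℝ} {G : E3 → E3}
    (hb : ∀ r, HasDerivAt b (b' r) r) (hbC : ∀ r, 0 ≤ r → |b r| ≤ C)
    (hΦ : ∀ x, HasGradientAt Φ (G x) x) (hΦ0 : Tendsto Φ (cocompact E3) (𝓝 0))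
    (h1 : Integrable fun x => inner ℝ (radialField b x) (G x))
    (h2 : Integrable fun x => b' ‖x‖ / ‖x‖ ^ 2 * Φ x) :
    ∫ x, inner ℝ (radialField b x) (G x)
      = -(∫ x, b' ‖x‖ / ‖x‖ ^ 2 * Φ x) - 4 * Real.pi * (b 0 * Φ 0) := by
  -- On the ray through θ, r² times the sum of the two integrands is the derivative of b(r) Φ(rθ).
  -- The end at infinity vanishes, leaving -b(0) Φ(0) on every ray.
  have h12 := integral_eq_of_integral_rays (h1.add h2) (c := -(b 0 * Φ 0)) ?_
  · simp only [Pi.add_apply] at h12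
    rw [integral_add h1 h2] at h12
    linarith
  intro θ hθ
  have hn : ‖(θ : E3)‖ = 1 := by simp
  have hder : ∀ r : ℝ, HasDerivAt (fun r : ℝ => b r * Φ (r • (θ : E3)))
      (b' r * Φ (r • (θ : E3)) + b r * inner ℝ (G (r • (θ : E3))) (θ : E3)) r := by
    intro r
    have h3 : HasDerivAt (fun r : ℝ => r • (θ : E3)) ((1 : ℝ) • (θ : E3)) r :=
      (hasDerivAt_id r).smul_const _
    have h4 := ((hΦ (r • (θ : E3))).hasFDerivAt).comp_hasDerivAt r h3
    have h5 := (hb r).mul h4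
    simp only [one_smul] at h5
    exact h5
  have hcongr : ∀ r ∈ Ioi (0 : ℝ), r ^ 2 * ((fun x => inner ℝ (radialField b x) (G x)) +
      fun x => b' ‖x‖ / ‖x‖ ^ 2 * Φ x) (r • (θ : E3))
      = b' r * Φ (r • (θ : E3)) + b r * inner ℝ (G (r • (θ : E3))) (θ : E3) := by
    intro r hr
    have hr : 0 < r := hr
    simp only [Pi.add_apply, radialField, norm_smul, hn, Real.norm_eq_abs, abs_of_pos hr, mul_one,
      inner_smul_left, inner_smul_right, RCLike.conj_to_real, real_inner_comm (G (r • (θ : E3)))]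
    field_simp
    ring
  rw [setIntegral_congr_fun measurableSet_Ioi hcongr]
  rw [integrableOn_congr_fun hcongr measurableSet_Ioi] at hθ
  rw [integral_Ioi_of_hasDerivAt_of_tendsto' (m := 0) (fun r _ => hder r) hθ]
  · simp
  · have hT : Tendsto (fun r : ℝ => Φ (r • (θ : E3))) atTop (𝓝 0) := by
      refine hΦ0.comp ?_
      rw [← Metric.cobounded_eq_cocompact, ← comap_norm_atTop, tendsto_comap_iff]
      refine (tendsto_abs_atTop_atTop).congr fun r => ?_
      simp [norm_smul]
    refine squeeze_zero_norm' (a := fun r => C * |Φ (r • (θ : E3))|) ?_ ?_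
    · filter_upwards [eventually_ge_atTop 0] with r hr
      rw [norm_mul, Real.norm_eq_abs, Real.norm_eq_abs]
      gcongr
      exact hbC r hr
    · simpa using hT.abs.const_mul C

end Polar

/-! ### Smoothing the singularity at the origin -/

section Regularization

/-- The regularized norm `√(|x|² + ε²)`. -/
noncomputable def regNorm (ε : ℝ) (x : E3) : ℝ := √(‖x‖ ^ 2 + ε ^ 2)

theorem regNorm_pos {ε : ℝ} (hε : 0 < ε) (x : E3) : 0 < regNorm ε x :=
  Real.sqrt_pos.2 (by positivity)

theorem norm_le_regNorm (ε : ℝ) (x : E3) : ‖x‖ ≤ regNorm ε x :=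
  Real.le_sqrt_of_sq_le (by nlinarith [sq_nonneg ε])

theorem continuous_regNorm (ε : ℝ) : Continuous (regNorm ε) := by
  unfold regNorm; fun_prop

theorem tendsto_regNorm (x : E3) {ε : ℕ → ℝ} (hε : Tendsto ε atTop (𝓝 0)) :
    Tendsto (fun n => regNorm (ε n) x) atTop (𝓝 ‖x‖) := by
  have : Tendsto (fun n => √(‖x‖ ^ 2 + ε n ^ 2)) atTop (𝓝 √(‖x‖ ^ 2 + 0 ^ 2)) :=
    ((tendsto_const_nhds.add (hε.pow 2)).sqrt)
  simpa [Real.sqrt_sq (norm_nonneg x), regNorm] using this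

/-- A profile g is encoded by the flux function b with g' = b/s². By the chain rule the
regularization changes |x| into √(|x|²+ε²) in the coefficient of the field and leaves the factor x
alone. -/
theorem hasGradientAt_comp_regNorm {g b : ℝ → ℝ} (hg : ∀ s, 0 < s → HasDerivAt g (b s / s ^ 2) s)
    {ε : ℝ} (hε : 0 < ε) (x : E3) :
    HasGradientAt (fun x => g (regNorm ε x)) ((b (regNorm ε x) / regNorm ε x ^ 3) • x) x := by
  have hs := regNorm_pos hε x
  have h1 : HasFDerivAt (fun x : E3 => ‖x‖ ^ 2 + ε ^ 2) (2 • innerSL ℝ x) x :=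
    ((hasStrictFDerivAt_norm_sq x).hasFDerivAt).add_const _
  have h2 := h1.sqrt (by positivity : ‖x‖ ^ 2 + ε ^ 2 ≠ 0)
  have h3 := (hg _ hs).comp_hasFDerivAt x h2
  rw [hasGradientAt_iff_hasFDerivAt]
  refine h3.congr_fderiv ?_
  have e : √(‖x‖ ^ 2 + ε ^ 2) = regNorm ε x := rfl
  ext v
  simp [e]
  field_simp

end Regularization

/-! ### Radial profiles of K and Y, with pointwise bounds -/

section Profiles

/-- The flux function of the gradient of the Bopp-Podolsky kernel. -/
noncomputable def fluxK (r : ℝ) : ℝ := Real.exp (-r) * (1 + r) - 1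

/-- The flux function of the gradient of the Yukawa kernel. -/
noncomputable def fluxY (r : ℝ) : ℝ := -(Real.exp (-r) * (1 + r))

/-- The radial profile of the Bopp-Podolsky kernel. -/
noncomputable def profileK (r : ℝ) : ℝ := (1 - Real.exp (-r)) / r

/-- The radial profile of the Yukawa kernel. -/
noncomputable def profileY (r : ℝ) : ℝ := Real.exp (-r) / r

theorem hasDerivAt_exp_neg (r : ℝ) :
    HasDerivAt (fun r : ℝ => Real.exp (-r)) (-Real.exp (-r)) r := by
  simpa using (hasDerivAt_neg r).exp

theorem hasDerivAt_fluxK (r : ℝ) : HasDerivAt fluxK (-(r * Real.exp (-r))) r := by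
  have := ((hasDerivAt_exp_neg r).mul ((hasDerivAt_id r).const_add 1)).sub_const 1
  refine this.congr_deriv ?_
  simp; ring

theorem hasDerivAt_fluxY (r : ℝ) : HasDerivAt fluxY (r * Real.exp (-r)) r := by
  have := ((hasDerivAt_exp_neg r).mul ((hasDerivAt_id r).const_add 1)).neg
  refine this.congr_deriv ?_
  simp; ring

theorem hasDerivAt_profileK (r : ℝ) (hr : 0 < r) :
    HasDerivAt profileK (fluxK r / r ^ 2) r := by
  refine (((hasDerivAt_exp_neg r).const_sub 1).div (hasDerivAt_id r) hr.ne').congr_deriv ?_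
  simp [fluxK]; ring

theorem hasDerivAt_profileY (r : ℝ) (hr : 0 < r) :
    HasDerivAt profileY (fluxY r / r ^ 2) r := by
  refine ((hasDerivAt_exp_neg r).div (hasDerivAt_id r) hr.ne').congr_deriv ?_
  simp [fluxY]; ring

theorem exp_neg_mul_le_one {r : ℝ} : Real.exp (-r) * (1 + r) ≤ 1 := by
  rw [Real.exp_neg, inv_mul_le_iff₀ (Real.exp_pos r)]
  linarith [Real.add_one_le_exp r]

theorem exp_neg_mul_nonneg {r : ℝ} (hr : 0 ≤ r) : 0 ≤ Real.exp (-r) * (1 + r) := by positivity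

theorem abs_fluxK_le_one {r : ℝ} (hr : 0 ≤ r) : |fluxK r| ≤ 1 := by
  rw [abs_le, fluxK]; constructor <;> linarith [@exp_neg_mul_le_one r, exp_neg_mul_nonneg hr]

theorem abs_fluxY_le_one {r : ℝ} (hr : 0 ≤ r) : |fluxY r| ≤ 1 := by
  rw [abs_le, fluxY]; constructor <;> linarith [@exp_neg_mul_le_one r, exp_neg_mul_nonneg hr]

/-- Combines |b| ≤ 1, which governs infinity, with |b| ≤ r², which governs the origin. It makes ∇K
bounded as well as O(|x|⁻²). -/
theorem abs_fluxK_le {r : ℝ} (hr : 0 ≤ r) : |fluxK r| ≤ 2 * r ^ 2 / (1 + r ^ 2) := by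
  have h1 : |fluxK r| ≤ r ^ 2 := by
    rw [abs_le, fluxK]
    constructor
    -- Here exp(-r) ≥ 1 - r gives exp(-r)(1+r) - 1 ≥ (1-r)(1+r) - 1 = -r².
    · nlinarith [Real.add_one_le_exp (-r)]
    · nlinarith [@exp_neg_mul_le_one r, sq_nonneg r]
  rw [le_div_iff₀ (by positivity)]
  nlinarith [abs_fluxK_le_one hr, abs_nonneg (fluxK r), sq_nonneg r]

theorem profileK_nonneg {r : ℝ} (hr : 0 ≤ r) : 0 ≤ profileK r :=
  div_nonneg (by simpa using hr) hr

theorem profileY_nonneg {r : ℝ} (hr : 0 ≤ r) : 0 ≤ profileY r :=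
  div_nonneg (Real.exp_pos _).le hr

theorem profileK_le_one {r : ℝ} (hr : 0 ≤ r) : profileK r ≤ 1 := by
  refine div_le_one_of_le₀ ?_ hr
  linarith [Real.add_one_le_exp (-r)]

theorem abs_profileK_le_inv {r : ℝ} (hr : 0 ≤ r) : |profileK r| ≤ r⁻¹ := by
  rw [abs_of_nonneg (profileK_nonneg hr), profileK, div_eq_mul_inv]
  exact mul_le_of_le_one_left (inv_nonneg.2 hr) (by linarith [Real.exp_pos (-r)])

theorem abs_profileY_le_inv {r : ℝ} (hr : 0 ≤ r) : |profileY r| ≤ r⁻¹ := by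
  rw [abs_of_nonneg (profileY_nonneg hr), profileY, div_eq_mul_inv]
  exact mul_le_of_le_one_left (inv_nonneg.2 hr) (by simpa using hr)

theorem profileY_anti {r s : ℝ} (hr : 0 < r) (hrs : r ≤ s) : profileY s ≤ profileY r := by
  unfold profileY; gcongr

theorem profileK_le {r : ℝ} (hr : 0 ≤ r) : profileK r ≤ 2 * (1 + r)⁻¹ := by
  have h1 := profileK_le_one hr
  have h2 : r * profileK r ≤ 1 := by
    rcases hr.eq_or_lt with rfl | hr
    · simp
    · have := abs_profileK_le_inv hr.le
      rw [abs_of_nonneg (profileK_nonneg hr.le)] at this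
      calc r * profileK r ≤ r * r⁻¹ := by gcongr
        _ = 1 := mul_inv_cancel₀ hr.ne'
  rw [← div_eq_mul_inv, le_div_iff₀ (by positivity)]
  linarith

/-- A rearrangement of exp(-r)(1+r) ≤ 1. With `profileK_le` it makes K comparable to (1+|x|)⁻¹,
which replaces K in absolute estimates. -/
theorem inv_le_profileK {r : ℝ} (hr : 0 < r) : (1 + r)⁻¹ ≤ profileK r := by
  have := @exp_neg_mul_le_one r
  rw [profileK, inv_eq_one_div, div_le_div_iff₀ (by positivity) hr]
  linarith

/-- Allowing any s ≥ |x| lets one estimate serve both the field itself, s = |x|, and its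
regularizations, s = √(|x|²+ε²). -/
theorem norm_flux_smul_le (b : ℝ → ℝ) {s : ℝ} (hs : 0 < s) {x : E3} (hx : ‖x‖ ≤ s) :
    ‖(b s / s ^ 3) • x‖ ≤ |b s| / s ^ 2 := by
  rw [norm_smul, Real.norm_eq_abs, abs_div, abs_of_pos (by positivity : 0 < s ^ 3),
    div_mul_eq_mul_div, div_le_div_iff₀ (by positivity) (by positivity)]
  calc |b s| * ‖x‖ * s ^ 2 ≤ |b s| * s * s ^ 2 := by gcongr
    _ = |b s| * s ^ 3 := by ring

theorem norm_flux_smul_le_inv_sq {b : ℝ → ℝ} (hb : ∀ s, 0 ≤ s → |b s| ≤ 1) {s : ℝ}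
    {x : E3} (hx : ‖x‖ ≤ s) : ‖(b s / s ^ 3) • x‖ ≤ (‖x‖ ^ 2)⁻¹ := by
  rcases eq_or_ne x 0 with rfl | hx0
  · simp
  have hx1 : 0 < ‖x‖ := norm_pos_iff.2 hx0
  have hs : 0 < s := hx1.trans_le hx
  refine (norm_flux_smul_le b hs hx).trans ?_
  rw [inv_eq_one_div]
  gcongr
  exact hb s hs.le

theorem norm_fluxK_smul_le {s : ℝ} (hs : 0 ≤ s) {x : E3} (hx : ‖x‖ ≤ s) :
    ‖(fluxK s / s ^ 3) • x‖ ≤ 2 * (1 + ‖x‖ ^ 2)⁻¹ := by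
  rcases hs.eq_or_lt with rfl | hs
  · simp; positivity
  refine (norm_flux_smul_le fluxK hs hx).trans ?_
  rw [← div_eq_mul_inv]
  refine le_trans ?_ (by gcongr : 2 / (1 + s ^ 2) ≤ 2 / (1 + ‖x‖ ^ 2))
  rw [div_le_iff₀ (by positivity)]
  refine (abs_fluxK_le hs.le).trans (le_of_eq ?_)
  ring

/-- The gradient of the Bopp-Podolsky kernel. -/
noncomputable def gradK : E3 → E3 := radialField fluxK

/-- The gradient of the Yukawa kernel. -/
noncomputable def gradY : E3 → E3 := radialField fluxY

/-- The Yukawa kernel `exp (-|x|) / |x|`, which is minus the Laplacian of the Bopp-Podolsky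
kernel. -/
noncomputable def yukawa (x : E3) : ℝ := profileY ‖x‖

theorem norm_gradK_le (x : E3) : ‖gradK x‖ ≤ 2 * (1 + ‖x‖ ^ 2)⁻¹ :=
  norm_fluxK_smul_le (norm_nonneg x) le_rfl

theorem kernel_eq (x : E3) : kernel x = profileK ‖x‖ := rfl

theorem kernel_nonneg (x : E3) : 0 ≤ kernel x := profileK_nonneg (norm_nonneg x)

theorem yukawa_nonneg (x : E3) : 0 ≤ yukawa x := profileY_nonneg (norm_nonneg x)

theorem kernel_neg (x : E3) : kernel (-x) = kernel x := by simp [kernel]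

theorem radialField_neg (b : ℝ → ℝ) (x : E3) : radialField b (-x) = -radialField b x := by
  simp [radialField]

theorem measurable_kernel : Measurable kernel := by unfold kernel; fun_prop

theorem measurable_yukawa : Measurable yukawa := by unfold yukawa profileY; fun_prop

theorem continuous_fluxK : Continuous fluxK := by unfold fluxK; fun_prop

theorem continuous_fluxY : Continuous fluxY := by unfold fluxY; fun_prop

theorem measurable_radialField {b : ℝ → ℝ} (hb : Continuous b) : Measurable (radialField b) := by
  have := hb.measurable
  unfold radialField; fun_prop

theorem measurable_gradK : Measurable gradK := measurable_radialField continuous_fluxK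

end Profiles

/-! ### Integrability of the kernels and of products of their translates -/

section Integrability

/-- The Jacobian of polar coordinates is r², so r² f(r) need only be bounded on bounded intervals.
-/
theorem locallyIntegrable_of_sq_mul_le {f : ℝ → ℝ} (hf : Measurable f)
    (h : ∀ R, ∃ C, ∀ r, 0 < r → r < R → |r ^ 2 * f r| ≤ C) :
    LocallyIntegrable fun x : E3 => f ‖x‖ := by
  rw [locallyIntegrable_iff]
  intro k hk
  obtain ⟨R, hR⟩ := hk.isBounded.subset_ball 0
  refine IntegrableOn.mono_set ?_ hR
  rw [integrableOn_fun_norm_addHaar, finrank_E3]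
  obtain ⟨C, hC⟩ := h R
  refine Measure.integrableOn_of_bounded (M := C) (by simp) ?_ ?_
  · exact (by fun_prop : Measurable fun y : ℝ => y ^ (3 - 1) • f y).aestronglyMeasurable
  · filter_upwards [ae_restrict_mem measurableSet_Ioo] with r hr
    exact hC r hr.1 hr.2

theorem locallyIntegrable_inv_norm_sq : LocallyIntegrable fun x : E3 => (‖x‖ ^ 2)⁻¹ := by
  refine locallyIntegrable_of_sq_mul_le (f := fun r => (r ^ 2)⁻¹) (by fun_prop) fun R =>
    ⟨1, fun r hr _ => ?_⟩
  rw [mul_inv_cancel₀ (by positivity)]; simp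

theorem locallyIntegrable_inv_norm : LocallyIntegrable fun x : E3 => ‖x‖⁻¹ := by
  refine locallyIntegrable_of_sq_mul_le (f := fun r => r⁻¹) (by fun_prop) fun R =>
    ⟨R, fun r hr hR => ?_⟩
  rw [abs_of_pos (by positivity), sq, mul_assoc, mul_inv_cancel₀ hr.ne']; linarith

theorem integrableOn_mul_exp_neg : IntegrableOn (fun r : ℝ => r * Real.exp (-r)) (Ioi 0) := by
  have := Real.GammaIntegral_convergent (s := 2) (by norm_num)
  refine this.congr_fun (fun r _ => ?_) measurableSet_Ioi
  norm_num
  ring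

theorem integrable_yukawa : Integrable yukawa := by
  refine integrable_radial (f := profileY) (integrableOn_mul_exp_neg.congr_fun (fun r hr => ?_)
    measurableSet_Ioi)
  have hr : 0 < r := hr
  simp only [profileY]; field_simp

theorem integrable_one_add_norm_mul_yukawa : Integrable fun x : E3 => (1 + ‖x‖) * yukawa x := by
  refine integrable_radial (f := fun r => (1 + r) * profileY r) ?_
  have h3 := Real.GammaIntegral_convergent (s := 3) (by norm_num)
  refine (integrableOn_mul_exp_neg.add h3).congr_fun (fun r hr => ?_) measurableSet_Ioi
  have hr : 0 < r := hr
  simp only [profileY, Pi.add_apply]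
  norm_num
  field_simp

theorem integrable_yukawa_sq : Integrable fun x : E3 => yukawa x ^ 2 := by
  refine integrable_radial (f := fun r => profileY r ^ 2) ?_
  have h3 := integrableOn_exp_mul_Ioi (a := -2) (by norm_num) 0
  refine h3.congr_fun (fun r hr => ?_) measurableSet_Ioi
  have hr : 0 < r := hr
  simp only [profileY]
  field_simp
  rw [← Real.exp_nat_mul]; congr 1; push_cast; ring

theorem integrable_yukawa_mul_yukawa (x y : E3) :
    Integrable fun z => yukawa (z - x) * yukawa (z - y) := by
  refine ((integrable_yukawa_sq.comp_sub_right x).add (integrable_yukawa_sq.comp_sub_right y)).mono'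
    ?_ (ae_of_all _ fun z => ?_)
  · have := measurable_yukawa
    exact (by fun_prop : Measurable fun z => yukawa (z - x) * yukawa (z - y)).aestronglyMeasurable
  · rw [Real.norm_eq_abs, abs_of_nonneg (mul_nonneg (yukawa_nonneg _) (yukawa_nonneg _))]
    simp only [Pi.add_apply]
    nlinarith [sq_nonneg (yukawa (z - x) - yukawa (z - y)), sq_nonneg (yukawa (z - x)),
      sq_nonneg (yukawa (z - y))]

theorem one_add_norm_sq_le (z w : E3) :
    1 + ‖z‖ ^ 2 ≤ 2 * (1 + ‖w‖ ^ 2) * (1 + ‖z - w‖ ^ 2) := by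
  have h : ‖z‖ ≤ ‖z - w‖ + ‖w‖ := by simpa using norm_add_le (z - w) w
  have h2 : ‖z‖ ^ 2 ≤ (‖z - w‖ + ‖w‖) ^ 2 := by gcongr
  nlinarith [sq_nonneg (‖z - w‖ - ‖w‖), mul_nonneg (sq_nonneg ‖w‖) (sq_nonneg ‖z - w‖)]

/-- The translated weight is at most 2(1+|w|²) times the centred one, which reduces the claim to the
radial integral of 1/(1+r²). -/
theorem integrable_inv_norm_sq_mul_inv (w : E3) :
    Integrable fun z : E3 => (‖z‖ ^ 2)⁻¹ * (1 + ‖z - w‖ ^ 2)⁻¹ := by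
  have h : Integrable fun z : E3 => (‖z‖ ^ 2)⁻¹ * (1 + ‖z‖ ^ 2)⁻¹ := by
    refine integrable_radial (f := fun r => (r ^ 2)⁻¹ * (1 + r ^ 2)⁻¹) ?_
    refine (integrable_inv_one_add_sq.integrableOn (s := Ioi 0)).congr_fun (fun r hr => ?_)
      measurableSet_Ioi
    have hr : 0 < r := hr
    field_simp
  refine (h.const_mul (2 * (1 + ‖w‖ ^ 2))).mono' ?_ (ae_of_all _ fun z => ?_)
  · exact (by fun_prop : Measurable fun z : E3 =>
      (‖z‖ ^ 2)⁻¹ * (1 + ‖z - w‖ ^ 2)⁻¹).aestronglyMeasurable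
  · rw [Real.norm_eq_abs, abs_of_nonneg (by positivity), mul_left_comm]
    gcongr
    rw [← div_eq_mul_inv, inv_eq_one_div, div_le_div_iff₀ (by positivity) (by positivity)]
    linarith [one_add_norm_sq_le z w]

/-- `∫ (1 + |z - x|²)⁻¹ (1 + |z - y|²)⁻¹ dz` is finite and decays like `|x - y|⁻¹`. -/
theorem integral_inv_mul_inv_le : ∃ C : ℝ, ∀ x y : E3,
    Integrable (fun z : E3 => (1 + ‖z - x‖ ^ 2)⁻¹ * (1 + ‖z - y‖ ^ 2)⁻¹) ∧
    ∫ z : E3, (1 + ‖z - x‖ ^ 2)⁻¹ * (1 + ‖z - y‖ ^ 2)⁻¹ ≤ C * (1 + ‖x - y‖)⁻¹ := by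
  -- With c = (1+|x-y|)/2 the integrand is at most twice the sum of two translates of a function of
  -- integral at most 4π·π/(2c); in total 8π²/c = 16π²/(1+|x-y|).
  refine ⟨16 * Real.pi ^ 2, fun x y => ?_⟩
  set c : ℝ := (1 + ‖x - y‖) / 2 with hc
  have hc0 : 0 < c := by positivity
  have hi : IntegrableOn (fun r : ℝ => c⁻¹ ^ 2 * (1 + (c⁻¹ * r) ^ 2)⁻¹) (Ioi 0) :=
    (((integrable_inv_one_add_sq.comp_mul_left' (inv_ne_zero hc0.ne')).const_mul _)).integrableOn
  -- Dropping the factor r²/(1+r²) ≤ 1 leaves 1/(r²+c²), whose integral over (0,∞) is π/(2c).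
  have hle : ∀ r : ℝ, 0 < r → r ^ 2 * ((1 + r ^ 2)⁻¹ * (r ^ 2 + c ^ 2)⁻¹) ≤
      c⁻¹ ^ 2 * (1 + (c⁻¹ * r) ^ 2)⁻¹ := by
    intro r hr
    have e : c⁻¹ ^ 2 * (1 + (c⁻¹ * r) ^ 2)⁻¹ = 1 * (r ^ 2 + c ^ 2)⁻¹ := by
      field_simp; ring
    rw [e, ← mul_assoc]
    gcongr
    rw [← div_eq_mul_inv, div_le_one (by positivity)]; linarith
  have hh1 : IntegrableOn (fun r : ℝ => r ^ 2 * ((1 + r ^ 2)⁻¹ * (r ^ 2 + c ^ 2)⁻¹)) (Ioi 0) := by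
    refine hi.mono' (by fun_prop : Measurable _).aestronglyMeasurable ?_
    filter_upwards [ae_restrict_mem measurableSet_Ioi] with r hr
    rw [Real.norm_eq_abs, abs_of_nonneg (by positivity)]
    exact hle r hr
  have hH : Integrable fun z : E3 => (1 + ‖z‖ ^ 2)⁻¹ * (‖z‖ ^ 2 + c ^ 2)⁻¹ :=
    integrable_radial (f := fun r => (1 + r ^ 2)⁻¹ * (r ^ 2 + c ^ 2)⁻¹) hh1
  have hHi : ∫ z : E3, (1 + ‖z‖ ^ 2)⁻¹ * (‖z‖ ^ 2 + c ^ 2)⁻¹ ≤ 4 * Real.pi * (c⁻¹ * (Real.pi / 2)) := by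
    rw [integral_radial (fun r => (1 + r ^ 2)⁻¹ * (r ^ 2 + c ^ 2)⁻¹)]
    gcongr
    refine (setIntegral_mono_on hh1 hi measurableSet_Ioi fun r hr => hle r hr).trans (le_of_eq ?_)
    rw [integral_const_mul, integral_comp_mul_left_Ioi (fun r => (1 + r ^ 2)⁻¹) 0
      (inv_pos.2 hc0)]
    simp
    field_simp
  have hpt : ∀ z : E3, (1 + ‖z - x‖ ^ 2)⁻¹ * (1 + ‖z - y‖ ^ 2)⁻¹ ≤
      2 * ((1 + ‖z - x‖ ^ 2)⁻¹ * (‖z - x‖ ^ 2 + c ^ 2)⁻¹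
        + (1 + ‖z - y‖ ^ 2)⁻¹ * (‖z - y‖ ^ 2 + c ^ 2)⁻¹) := by
    intro z
    set A := ‖z - x‖
    set B := ‖z - y‖
    have hd : ‖x - y‖ ≤ A + B := by
      have := norm_sub_le (z - y) (z - x)
      rw [sub_sub_sub_cancel_left] at this
      linarith
    have hdn := norm_nonneg (x - y)
    have hA : 0 ≤ A := norm_nonneg _
    have hB : 0 ≤ B := norm_nonneg _
    have hcAB : c ^ 2 ≤ 1 + A ^ 2 + B ^ 2 + 1 := by
      have h1 : c ^ 2 ≤ ((1 + (A + B)) / 2) ^ 2 := by rw [hc]; gcongr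
      nlinarith [sq_nonneg (A - B), sq_nonneg (A + B - 1)]
    have hS : 0 < (1 + A ^ 2) + (1 + B ^ 2) := by positivity
    -- Partial fractions: 1/(ab) = (1/a + 1/b)/(a+b). Since c² ≤ a + b by the triangle inequality,
    -- 1/(a+b) is in turn bounded by 2/(A²+c²) and by 2/(B²+c²).
    have e : (1 + A ^ 2)⁻¹ * (1 + B ^ 2)⁻¹ = (1 + A ^ 2)⁻¹ * ((1 + A ^ 2) + (1 + B ^ 2))⁻¹
        + (1 + B ^ 2)⁻¹ * ((1 + A ^ 2) + (1 + B ^ 2))⁻¹ := by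
      field_simp; ring
    have k1 : ((1 + A ^ 2) + (1 + B ^ 2))⁻¹ ≤ 2 * (A ^ 2 + c ^ 2)⁻¹ := by
      rw [← div_eq_mul_inv, inv_eq_one_div, div_le_div_iff₀ hS (by positivity)]
      nlinarith [sq_nonneg B]
    have k2 : ((1 + A ^ 2) + (1 + B ^ 2))⁻¹ ≤ 2 * (B ^ 2 + c ^ 2)⁻¹ := by
      rw [← div_eq_mul_inv, inv_eq_one_div, div_le_div_iff₀ hS (by positivity)]
      nlinarith [sq_nonneg A]
    rw [e]
    have k3 : (1 + A ^ 2)⁻¹ * ((1 + A ^ 2) + (1 + B ^ 2))⁻¹ ≤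
      (1 + A ^ 2)⁻¹ * (2 * (A ^ 2 + c ^ 2)⁻¹) := by gcongr
    have k4 : (1 + B ^ 2)⁻¹ * ((1 + A ^ 2) + (1 + B ^ 2))⁻¹ ≤
      (1 + B ^ 2)⁻¹ * (2 * (B ^ 2 + c ^ 2)⁻¹) := by gcongr
    linarith
  have hdom := ((hH.comp_sub_right x).add (hH.comp_sub_right y)).const_mul 2
  have hint : Integrable (fun z : E3 => (1 + ‖z - x‖ ^ 2)⁻¹ * (1 + ‖z - y‖ ^ 2)⁻¹) := by
    refine hdom.mono' (by fun_prop : Measurable _).aestronglyMeasurable (ae_of_all _ fun z => ?_)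
    rw [Real.norm_eq_abs, abs_of_nonneg (by positivity)]
    exact hpt z
  refine ⟨hint, (integral_mono hint hdom hpt).trans ?_⟩
  simp only [Pi.add_apply]
  rw [integral_const_mul, integral_add (hH.comp_sub_right x) (hH.comp_sub_right y),
    integral_sub_right_eq_self (fun z : E3 => (1 + ‖z‖ ^ 2)⁻¹ * (‖z‖ ^ 2 + c ^ 2)⁻¹) x,
    integral_sub_right_eq_self (fun z : E3 => (1 + ‖z‖ ^ 2)⁻¹ * (‖z‖ ^ 2 + c ^ 2)⁻¹) y]
  calc _ ≤ 2 * (4 * Real.pi * (c⁻¹ * (Real.pi / 2)) + 4 * Real.pi * (c⁻¹ * (Real.pi / 2))) := by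
        gcongr
    _ = _ := by rw [hc]; field_simp; ring

end Integrability

/-! ### Integration by parts for the kernels and the reproducing identity -/

section KernelIdentities

theorem tendsto_comp_regNorm {g b : ℝ → ℝ} (hg : ∀ s, 0 < s → HasDerivAt g (b s / s ^ 2) s)
    {x : E3} (hx : x ≠ 0) {ε : ℕ → ℝ} (hε : Tendsto ε atTop (𝓝 0)) :
    Tendsto (fun n => g (regNorm (ε n) x)) atTop (𝓝 (g ‖x‖)) :=
  (hg _ (norm_pos_iff.2 hx)).continuousAt.tendsto.comp (tendsto_regNorm x hε)

theorem tendsto_field_regNorm {b : ℝ → ℝ} (hb : Continuous b)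
    {x : E3} (hx : x ≠ 0) {ε : ℕ → ℝ} (hε : Tendsto ε atTop (𝓝 0)) :
    Tendsto (fun n => (b (regNorm (ε n) x) / regNorm (ε n) x ^ 3) • x) atTop
      (𝓝 (radialField b x)) := by
  have h := tendsto_regNorm x hε
  refine Tendsto.smul_const ?_ x
  exact ((hb.tendsto _).comp h).div (h.pow 3) (pow_ne_zero _ (norm_ne_zero_iff.2 hx))

theorem exists_regularization : ∃ ε : ℕ → ℝ, (∀ n, 0 < ε n) ∧ Tendsto ε atTop (𝓝 0) :=
  ⟨fun n => 1 / ((n : ℝ) + 1), fun _ => by positivity, tendsto_one_div_add_atTop_nhds_zero_nat⟩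

theorem continuous_comp_regNorm {g b : ℝ → ℝ} (hg : ∀ s, 0 < s → HasDerivAt g (b s / s ^ 2) s)
    {ε : ℝ} (hε : 0 < ε) : Continuous fun x : E3 => g (regNorm ε x) :=
  continuous_iff_continuousAt.2 fun x => (hasGradientAt_comp_regNorm hg hε x).continuousAt

theorem continuous_field_regNorm {b : ℝ → ℝ} (hb : Continuous b) {ε : ℝ} (hε : 0 < ε) :
    Continuous fun x : E3 => (b (regNorm ε x) / regNorm ε x ^ 3) • x :=
  ((hb.comp (continuous_regNorm ε)).div ((continuous_regNorm ε).pow 3)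
    fun x => pow_ne_zero _ (regNorm_pos hε x).ne').smul continuous_id

/-- A radial kernel `g(|x|)`, no more singular than `|x|⁻¹`, has the expected distributional
derivatives. -/
theorem integral_profile_mul_fderiv {g b : ℝ → ℝ}
    (hg : ∀ s, 0 < s → HasDerivAt g (b s / s ^ 2) s) (hb : Continuous b)
    (hb1 : ∀ s, 0 ≤ s → |b s| ≤ 1) (hg1 : ∀ s, 0 ≤ s → |g s| ≤ s⁻¹)
    {φ : E3 → ℝ} (hφ : ContDiff ℝ 1 φ) (hc : HasCompactSupport φ) (v : E3) :
    ∫ x, g ‖x‖ * fderiv ℝ φ x v = -∫ x, inner ℝ (radialField b x) v * φ x := by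
  obtain ⟨ε, hε, hε0⟩ := exists_regularization
  have hφc := hφ.continuous
  have hφ' : Continuous fun x => fderiv ℝ φ x v :=
    (hφ.continuous_fderiv one_ne_zero).clm_apply continuous_const
  have hφ's : HasCompactSupport fun x => fderiv ℝ φ x v := hc.fderiv_apply ℝ v
  have hne : ∀ᵐ x : E3, x ≠ 0 := by
    simp [ae_iff]
  -- The regularized profile is differentiable everywhere, so ordinary integration by parts applies.
  -- The limit ε → 0 is dominated by the locally integrable |x|⁻¹ on one side and |x|⁻² on the
  -- other.
  have hstep : ∀ n, ∫ x, g (regNorm (ε n) x) * fderiv ℝ φ x v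
      = -∫ x, inner ℝ ((b (regNorm (ε n) x) / regNorm (ε n) x ^ 3) • x) v * φ x := by
    intro n
    have hgc := continuous_comp_regNorm hg (hε n)
    have hfc := continuous_field_regNorm hb (hε n)
    have hd := fun x => hasGradientAt_comp_regNorm hg (hε n) x
    have hfd : ∀ x, fderiv ℝ (fun x => g (regNorm (ε n) x)) x v
        = inner ℝ ((b (regNorm (ε n) x) / regNorm (ε n) x ^ 3) • x) v :=
      fun x => (hd x).fderiv_apply
    simp_rw [← hfd]
    refine integral_mul_fderiv_eq_neg_fderiv_mul_of_integrable ?_ ?_ ?_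
      (fun x _ => (hd x).differentiableAt)
      (fun x _ => (hφ.differentiable one_ne_zero) x)
    · simp_rw [hfd]
      exact ((hfc.inner continuous_const).mul hφc).integrable_of_hasCompactSupport hc.mul_left
    · exact (hgc.mul hφ').integrable_of_hasCompactSupport hφ's.mul_left
    · exact (hgc.mul hφc).integrable_of_hasCompactSupport hc.mul_left
  have hL : Tendsto (fun n => ∫ x, g (regNorm (ε n) x) * fderiv ℝ φ x v) atTop
      (𝓝 (∫ x, g ‖x‖ * fderiv ℝ φ x v)) := by
    refine tendsto_integral_of_dominated_convergence
      (fun x => ‖fderiv ℝ φ x v‖ • ‖x‖⁻¹) ?_ ?_ ?_ ?_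
    · intro n
      exact ((continuous_comp_regNorm hg (hε n)).mul hφ').aestronglyMeasurable
    · exact locallyIntegrable_inv_norm.integrable_smul_left_of_hasCompactSupport hφ'.norm hφ's.norm
    · intro n
      filter_upwards [hne] with x hx
      rw [norm_mul, mul_comm, smul_eq_mul, Real.norm_eq_abs (g _)]
      gcongr
      refine (hg1 _ (regNorm_pos (hε n) x).le).trans ?_
      have := norm_pos_iff.2 hx
      gcongr
      exact norm_le_regNorm _ _
    · filter_upwards [hne] with x hx
      exact (tendsto_comp_regNorm hg hx hε0).mul_const _
  have hR : Tendsto (fun n => ∫ x,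
      inner ℝ ((b (regNorm (ε n) x) / regNorm (ε n) x ^ 3) • x) v * φ x) atTop
      (𝓝 (∫ x, inner ℝ (radialField b x) v * φ x)) := by
    refine tendsto_integral_of_dominated_convergence
      (fun x => ‖v‖ * (‖φ x‖ • (‖x‖ ^ 2)⁻¹)) ?_ ?_ ?_ ?_
    · intro n
      exact (((continuous_field_regNorm hb (hε n)).inner
        continuous_const).mul hφc).aestronglyMeasurable
    · exact (locallyIntegrable_inv_norm_sq.integrable_smul_left_of_hasCompactSupport
        hφc.norm hc.norm).const_mul _
    · intro n
      refine ae_of_all _ fun x => ?_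
      rw [norm_mul]
      calc _ ≤ (‖(b (regNorm (ε n) x) / regNorm (ε n) x ^ 3) • x‖ * ‖v‖) * ‖φ x‖ := by
            gcongr; exact norm_inner_le_norm _ _
        _ ≤ ((‖x‖ ^ 2)⁻¹ * ‖v‖) * ‖φ x‖ := by
            gcongr
            exact norm_flux_smul_le_inv_sq hb1 (norm_le_regNorm _ _)
        _ = _ := by rw [smul_eq_mul]; ring
    · filter_upwards [hne] with x hx
      exact ((tendsto_field_regNorm hb hx hε0).inner tendsto_const_nhds).mul_const _
  refine tendsto_nhds_unique hL ?_
  simp_rw [hstep]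
  exact hR.neg

/-- The flux identity for a radial field tested against the translate of a radial profile. -/
theorem integral_inner_radialField_radialField {b b' g c : ℝ → ℝ} {C : ℝ}
    (hb : ∀ r, HasDerivAt b (b' r) r) (hbC : ∀ r, 0 ≤ r → |b r| ≤ C) (hb' : Measurable b')
    (hg : ∀ s, 0 < s → HasDerivAt g (c s / s ^ 2) s) (hc : Continuous c)
    (hg1 : ∀ s, 0 ≤ s → |g s| ≤ s⁻¹)
    {M₁ N₁ M₂ N₂ : E3 → ℝ} {w : E3} (hw : w ≠ 0)
    (h₁ : Integrable fun z => M₁ z * N₁ (z - w)) (h₂ : Integrable fun z => M₂ z * N₂ (z - w))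
    (hM₁ : ∀ z, ‖radialField b z‖ ≤ M₁ z) (hM₂ : ∀ z, z ≠ 0 → |b' ‖z‖ / ‖z‖ ^ 2| ≤ M₂ z)
    (hN₁ : ∀ z s, z ≠ 0 → ‖z‖ ≤ s → ‖(c s / s ^ 3) • z‖ ≤ N₁ z)
    (hN₂ : ∀ z s, z ≠ 0 → ‖z‖ ≤ s → |g s| ≤ N₂ z) :
    ∫ z, inner ℝ (radialField b z) (radialField c (z - w))
      = -(∫ z, b' ‖z‖ / ‖z‖ ^ 2 * g ‖z - w‖) - 4 * Real.pi * (b 0 * g ‖w‖) := by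
  obtain ⟨ε, hε, hε0⟩ := exists_regularization
  have hbc : Continuous b := continuous_iff_continuousAt.2 fun r => (hb r).continuousAt
  have hne : ∀ a : E3, ∀ᵐ x : E3, x ≠ a := by intro a; simp [ae_iff]
  have hm1 : ∀ n, AEStronglyMeasurable (fun z => inner ℝ (radialField b z)
      ((c (regNorm (ε n) (z - w)) / regNorm (ε n) (z - w) ^ 3) • (z - w))) := fun n =>
    (measurable_radialField hbc).aestronglyMeasurable.inner
      (((continuous_field_regNorm hc (hε n)).comp
        (continuous_id.sub continuous_const)).aestronglyMeasurable)
  have hm2 : ∀ n, AEStronglyMeasurable (fun z : E3 => b' ‖z‖ / ‖z‖ ^ 2 *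
      g (regNorm (ε n) (z - w))) := fun n =>
    (by fun_prop : Measurable fun z : E3 => b' ‖z‖ / ‖z‖ ^ 2).aestronglyMeasurable.mul
      (((continuous_comp_regNorm hg (hε n)).comp
        (continuous_id.sub continuous_const)).aestronglyMeasurable)
  have hd1 : ∀ n, ∀ᵐ z, ‖inner ℝ (radialField b z)
      ((c (regNorm (ε n) (z - w)) / regNorm (ε n) (z - w) ^ 3) • (z - w))‖
        ≤ M₁ z * N₁ (z - w) := by
    intro n
    filter_upwards [hne w] with z hz
    refine (norm_inner_le_norm _ _).trans ?_
    have := hM₁ z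
    exact mul_le_mul this (hN₁ _ _ (sub_ne_zero.2 hz) (norm_le_regNorm _ _)) (norm_nonneg _)
      ((norm_nonneg _).trans this)
  have hd2 : ∀ n, ∀ᵐ z : E3, ‖b' ‖z‖ / ‖z‖ ^ 2 * g (regNorm (ε n) (z - w))‖
        ≤ M₂ z * N₂ (z - w) := by
    intro n
    filter_upwards [hne w, hne 0] with z hz hz0
    rw [norm_mul]
    have := hM₂ z hz0
    exact mul_le_mul this (hN₂ _ _ (sub_ne_zero.2 hz) (norm_le_regNorm _ _)) (abs_nonneg _)
      ((abs_nonneg _).trans this)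
  -- Only the translated profile is regularized. The field b keeps its singularity at 0, which is
  -- the source of the flux term.
  have hstep : ∀ n, ∫ z, inner ℝ (radialField b z)
      ((c (regNorm (ε n) (z - w)) / regNorm (ε n) (z - w) ^ 3) • (z - w))
      = -(∫ z, b' ‖z‖ / ‖z‖ ^ 2 * g (regNorm (ε n) (z - w)))
        - 4 * Real.pi * (b 0 * g (regNorm (ε n) (0 - w))) := by
    intro n
    refine integral_inner_radialField (Φ := fun z => g (regNorm (ε n) (z - w))) hb hbC
      (fun z => ?_) ?_ (h₁.mono' (hm1 n) (hd1 n)) (h₂.mono' (hm2 n) (hd2 n))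
    · have h := hasGradientAt_comp_regNorm hg (hε n) (z - w)
      rw [hasGradientAt_iff_hasFDerivAt] at h ⊢
      exact (hasFDerivAt_comp_sub w).2 h
    · have ht : Tendsto (fun z : E3 => ‖z - w‖) (cocompact E3) atTop :=
        tendsto_norm_cocompact_atTop.comp (Homeomorph.subRight w).isClosedEmbedding.tendsto_cocompact
      refine squeeze_zero_norm' (a := fun z => ‖z - w‖⁻¹) ?_ (tendsto_inv_atTop_zero.comp ht)
      filter_upwards [ht.eventually (eventually_gt_atTop 0)] with z hz
      refine (hg1 _ (regNorm_pos (hε n) _).le).trans ?_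
      gcongr
      exact norm_le_regNorm _ _
  have hL := tendsto_integral_of_dominated_convergence
    (f := fun z => inner ℝ (radialField b z) (radialField c (z - w))) _ hm1 h₁ hd1 (by
      filter_upwards [hne w] with z hz
      exact tendsto_const_nhds.inner (tendsto_field_regNorm hc (sub_ne_zero.2 hz) hε0))
  have hR := tendsto_integral_of_dominated_convergence
    (f := fun z : E3 => b' ‖z‖ / ‖z‖ ^ 2 * g ‖z - w‖) _ hm2 h₂ hd2 (by
      filter_upwards [hne w] with z hz
      exact (tendsto_comp_regNorm hg (sub_ne_zero.2 hz) hε0).const_mul _)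
  refine tendsto_nhds_unique hL ?_
  simp_rw [hstep]
  refine hR.neg.sub (Tendsto.const_mul _ (Tendsto.const_mul _ ?_))
  have := tendsto_comp_regNorm hg (x := 0 - w) (by simpa using hw) hε0
  simpa using this

theorem neg_mul_exp_div_eq {z : E3} (hz : z ≠ 0) :
    -(‖z‖ * Real.exp (-‖z‖)) / ‖z‖ ^ 2 = -yukawa z := by
  have := norm_pos_iff.2 hz
  rw [yukawa, profileY]; field_simp

/-- ∇K has divergence -Y and no flux at the origin, so there is no point term. -/
theorem integral_gradK_inner_gradK {w : E3} (hw : w ≠ 0) :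
    ∫ z, inner ℝ (gradK z) (gradK (z - w)) = ∫ z, yukawa z * kernel (z - w) := by
  have h := integral_inner_radialField_radialField (b := fluxK) (c := fluxK) (g := profileK)
    hasDerivAt_fluxK (fun r => abs_fluxK_le_one) (by fun_prop) hasDerivAt_profileK
    continuous_fluxK (fun s => abs_profileK_le_inv) (w := w) hw
    (M₁ := fun z => (‖z‖ ^ 2)⁻¹) (N₁ := fun z => 2 * (1 + ‖z‖ ^ 2)⁻¹)
    (M₂ := yukawa) (N₂ := fun _ => 1)
    (by simpa [mul_left_comm] using (integrable_inv_norm_sq_mul_inv w).const_mul 2)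
    (by simpa using integrable_yukawa)
    (fun z => norm_flux_smul_le_inv_sq (fun _ => abs_fluxK_le_one) le_rfl)
    (fun z hz => by rw [neg_mul_exp_div_eq hz, abs_neg, abs_of_nonneg (yukawa_nonneg z)])
    (fun z s _ h => norm_fluxK_smul_le ((norm_nonneg z).trans h) h)
    (fun z s _ h => by
      have hs := (norm_nonneg z).trans h
      rw [abs_of_nonneg (profileK_nonneg hs)]
      exact profileK_le_one hs)
  rw [show fluxK 0 = 0 by simp [fluxK]] at h
  simp only [zero_mul, mul_zero, sub_zero] at h
  rw [gradK, h, ← integral_neg]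
  refine integral_congr_ae ?_
  filter_upwards [(by simp [ae_iff] : ∀ᵐ z : E3, z ≠ 0)] with z hz
  rw [neg_mul_exp_div_eq hz, kernel_eq]; ring

/-- ∇Y has divergence Y away from 0 and flux -4π at the origin; the latter produces the term 4πK(w).
-/
theorem integral_gradY_inner_gradK {w : E3} (hw : w ≠ 0) :
    ∫ z, inner ℝ (gradY z) (gradK (z - w))
      = 4 * Real.pi * kernel w - ∫ z, yukawa z * kernel (z - w) := by
  have e : ∀ z : E3, z ≠ 0 → ‖z‖ * Real.exp (-‖z‖) / ‖z‖ ^ 2 = yukawa z := fun z hz => by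
    rw [← neg_inj, ← neg_div]; exact neg_mul_exp_div_eq hz
  have h := integral_inner_radialField_radialField (b := fluxY) (c := fluxK) (g := profileK)
    hasDerivAt_fluxY (fun r => abs_fluxY_le_one) (by fun_prop) hasDerivAt_profileK
    continuous_fluxK (fun s => abs_profileK_le_inv) (w := w) hw
    (M₁ := fun z => (‖z‖ ^ 2)⁻¹) (N₁ := fun z => 2 * (1 + ‖z‖ ^ 2)⁻¹)
    (M₂ := yukawa) (N₂ := fun _ => 1)
    (by simpa [mul_left_comm] using (integrable_inv_norm_sq_mul_inv w).const_mul 2)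
    (by simpa using integrable_yukawa)
    (fun z => norm_flux_smul_le_inv_sq (fun _ => abs_fluxY_le_one) le_rfl)
    (fun z hz => by rw [e z hz, abs_of_nonneg (yukawa_nonneg z)])
    (fun z s _ h => norm_fluxK_smul_le ((norm_nonneg z).trans h) h)
    (fun z s _ h => by
      have hs := (norm_nonneg z).trans h
      rw [abs_of_nonneg (profileK_nonneg hs)]
      exact profileK_le_one hs)
  rw [show fluxY 0 = -1 by simp [fluxY]] at h
  have e2 : ∫ z : E3, ‖z‖ * Real.exp (-‖z‖) / ‖z‖ ^ 2 * profileK ‖z - w‖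
      = ∫ z, yukawa z * kernel (z - w) := by
    refine integral_congr_ae ?_
    filter_upwards [(by simp [ae_iff] : ∀ᵐ z : E3, z ≠ 0)] with z hz
    rw [e z hz, kernel_eq]
  rw [gradY, gradK, h, e2, kernel_eq]; ring

/-- A second evaluation of the integral in `integral_gradY_inner_gradK`: the reflection z ↦ w - z
exchanges the two factors, after which ∇K plays the field and Y the tested profile. -/
theorem integral_gradK_inner_gradY {w : E3} (hw : w ≠ 0) :
    ∫ z, inner ℝ (gradY z) (gradK (z - w)) = ∫ z, yukawa z * yukawa (z - w) := by
  have h := integral_inner_radialField_radialField (b := fluxK) (c := fluxY) (g := profileY)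
    hasDerivAt_fluxK (fun r => abs_fluxK_le_one) (by fun_prop) hasDerivAt_profileY
    continuous_fluxY (fun s => abs_profileY_le_inv) (w := w) hw
    (M₁ := fun z => 2 * (1 + ‖z‖ ^ 2)⁻¹) (N₁ := fun z => (‖z‖ ^ 2)⁻¹)
    (M₂ := yukawa) (N₂ := yukawa)
    (by simpa [mul_comm, mul_assoc, mul_left_comm] using
      ((integrable_inv_norm_sq_mul_inv (-w)).comp_sub_right w).const_mul 2)
    (by simpa using integrable_yukawa_mul_yukawa 0 w)
    norm_gradK_le
    (fun z hz => by rw [neg_mul_exp_div_eq hz, abs_neg, abs_of_nonneg (yukawa_nonneg z)])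
    (fun z s _ h => norm_flux_smul_le_inv_sq (fun _ => abs_fluxY_le_one) h)
    (fun z s hz h => by
      rw [abs_of_nonneg (profileY_nonneg ((norm_nonneg z).trans h))]
      -- Y is unbounded at 0, but it decreases in the radius, so its regularizations lie below it.
      exact profileY_anti (norm_pos_iff.2 hz) h)
  rw [show fluxK 0 = 0 by simp [fluxK]] at h
  simp only [zero_mul, mul_zero, sub_zero] at h
  have e1 : ∫ z, inner ℝ (gradY z) (gradK (z - w))
      = ∫ z, inner ℝ (radialField fluxK z) (radialField fluxY (z - w)) := by
    rw [← integral_sub_left_eq_self (fun z => inner ℝ (gradY z) (gradK (z - w))) volume w]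
    congr 1 with z
    rw [gradK, gradY, show w - z - w = -z by abel, show w - z = -(z - w) by abel,
      radialField_neg, radialField_neg, inner_neg_neg, real_inner_comm]
  rw [e1, h, ← integral_neg]
  refine integral_congr_ae ?_
  filter_upwards [(by simp [ae_iff] : ∀ᵐ z : E3, z ≠ 0)] with z hz
  rw [neg_mul_exp_div_eq hz, ← yukawa]; ring

/-- The reproducing identity behind the energy identity. -/
theorem integral_gradK_add_yukawa {x y : E3} (hxy : x ≠ y) :
    (∫ z, inner ℝ (gradK (z - x)) (gradK (z - y))) + ∫ z, yukawa (z - x) * yukawa (z - y)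
      = 4 * Real.pi * kernel (x - y) := by
  have hw : y - x ≠ 0 := sub_ne_zero.2 hxy.symm
  -- The first identity gives ∫ ∇K·∇K = ∫ YK; equating the other two gives ∫ YY = 4πK(w) - ∫ YK. The
  -- mixed integral cancels in the sum.
  have h1 := integral_gradK_inner_gradK hw
  have h2 := integral_gradY_inner_gradK hw
  have h3 := integral_gradK_inner_gradY hw
  rw [← integral_sub_right_eq_self (fun z => inner ℝ (gradK z) (gradK (z - (y - x)))) x] at h1
  rw [← integral_sub_right_eq_self (fun z => yukawa z * yukawa (z - (y - x))) x] at h3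
  simp only [sub_sub, add_sub_cancel] at h1 h3
  rw [← neg_sub x y, kernel_neg] at h2
  rw [← neg_sub x y] at h1 h3
  linarith

/-- ∇K(z-x)·∇K(z-y) has no fixed sign, so the reproducing identity does not control its absolute
value; the pointwise decay of ∇K does. -/
theorem integral_norm_gradK_mul_le : ∃ C : ℝ, ∀ x y : E3,
    Integrable (fun z : E3 => ‖gradK (z - x)‖ * ‖gradK (z - y)‖) ∧
    ∫ z : E3, ‖gradK (z - x)‖ * ‖gradK (z - y)‖ ≤ C * (1 + ‖x - y‖)⁻¹ := by
  obtain ⟨C, hC⟩ := integral_inv_mul_inv_le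
  refine ⟨4 * C, fun x y => ?_⟩
  have hle : ∀ z, ‖gradK (z - x)‖ * ‖gradK (z - y)‖
      ≤ 4 * ((1 + ‖z - x‖ ^ 2)⁻¹ * (1 + ‖z - y‖ ^ 2)⁻¹) := fun z => by
    calc _ ≤ (2 * (1 + ‖z - x‖ ^ 2)⁻¹) * (2 * (1 + ‖z - y‖ ^ 2)⁻¹) := by
          gcongr <;> exact norm_gradK_le _
      _ = _ := by ring
  have hi : Integrable (fun z : E3 => ‖gradK (z - x)‖ * ‖gradK (z - y)‖) := by
    refine ((hC x y).1.const_mul 4).mono' ?_ (ae_of_all _ fun z => ?_)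
    · have := measurable_gradK
      exact (by fun_prop :
        Measurable fun z => ‖gradK (z - x)‖ * ‖gradK (z - y)‖).aestronglyMeasurable
    · rw [Real.norm_eq_abs, abs_of_nonneg (by positivity)]
      exact hle z
  refine ⟨hi, (integral_mono hi ((hC x y).1.const_mul 4) hle).trans ?_⟩
  rw [integral_const_mul, mul_assoc]
  gcongr
  exact (hC x y).2

/-- The integral equals 4πK(x-y) minus an integral of the nonnegative product of Y and a translate
of K. -/
theorem integral_yukawa_mul_le {x y : E3} (hxy : x ≠ y) :
    ∫ z, yukawa (z - x) * yukawa (z - y) ≤ 4 * Real.pi * kernel (x - y) := by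
  have hw : y - x ≠ 0 := sub_ne_zero.2 hxy.symm
  have h2 := integral_gradY_inner_gradK hw
  have h3 := integral_gradK_inner_gradY hw
  have h4 : 0 ≤ ∫ z, yukawa z * kernel (z - (y - x)) :=
    integral_nonneg fun z => mul_nonneg (yukawa_nonneg _) (kernel_nonneg _)
  rw [← integral_sub_right_eq_self (fun z => yukawa z * yukawa (z - (y - x))) x] at h3
  simp only [sub_sub, add_sub_cancel] at h3
  rw [← neg_sub x y, kernel_neg] at h2
  rw [← neg_sub x y] at h3 h4
  linarith

end KernelIdentities

/-! ### Distributional derivatives of the kernels -/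

section TestFunctions

theorem IsTest.contDiff {φ : E3 → ℝ} (hφ : IsTest φ) (n : ℕ∞) : ContDiff ℝ n φ :=
  hφ.1.of_le (by exact_mod_cast le_top)

theorem IsTest.hasGradientAt {φ : E3 → ℝ} (hφ : IsTest φ) (x : E3) :
    HasGradientAt φ (∇ φ x) x :=
  ((hφ.1.differentiable (by simp)) x).hasGradientAt

theorem IsTest.fderiv_apply {φ : E3 → ℝ} (hφ : IsTest φ) (v : E3) :
    IsTest fun x => fderiv ℝ φ x v := by
  refine ⟨?_, hφ.2.fderiv_apply ℝ v⟩
  exact (hφ.1.fderiv_right (m := ∞) (by simp)).clm_apply contDiff_const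

theorem inner_gradient_eq {φ : E3 → ℝ} (x v : E3) : inner ℝ (∇ φ x) v = fderiv ℝ φ x v :=
  inner_gradient_left

theorem IsTest.continuous_gradient {φ : E3 → ℝ} (hφ : IsTest φ) : Continuous (∇ φ) :=
  (InnerProductSpace.toDual ℝ E3).symm.continuous.comp (hφ.1.continuous_fderiv (by simp))

theorem IsTest.hasCompactSupport_gradient {φ : E3 → ℝ} (hφ : IsTest φ) :
    HasCompactSupport (∇ φ) :=
  (hφ.2.fderiv ℝ).comp_left (g := (InnerProductSpace.toDual ℝ E3).symm) (map_zero _)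

theorem IsTest.laplacian_eq {φ : E3 → ℝ} (hφ : IsTest φ) {ι : Type*} [Fintype ι]
    (e : OrthonormalBasis ι ℝ E3) (x : E3) :
    Δ φ x = ∑ i, fderiv ℝ (fun x => fderiv ℝ φ x (e i)) x (e i) := by
  rw [InnerProductSpace.laplacian_eq_iteratedFDeriv_orthonormalBasis φ e]
  refine Finset.sum_congr rfl fun i _ => ?_
  have hd : DifferentiableAt ℝ (fderiv ℝ φ) x :=
    (hφ.1.fderiv_right (m := ∞) (by simp)).differentiable (by simp) x
  rw [iteratedFDeriv_two_apply, fderiv_clm_apply hd (by fun_prop)]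
  simp

theorem IsTest.continuous_laplacian {φ : E3 → ℝ} (hφ : IsTest φ) : Continuous (Δ φ) := by
  have h : Δ φ = fun x => ∑ i, fderiv ℝ (fun x => fderiv ℝ φ x
      (EuclideanSpace.basisFun (Fin 3) ℝ i)) x (EuclideanSpace.basisFun (Fin 3) ℝ i) :=
    funext fun x => hφ.laplacian_eq _ x
  rw [h]
  exact continuous_finsetSum _ fun i _ => ((hφ.fderiv_apply _).fderiv_apply _).1.continuous

theorem IsTest.hasCompactSupport_laplacian {φ : E3 → ℝ} (hφ : IsTest φ) :
    HasCompactSupport (Δ φ) := by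
  have h : Δ φ = fun x => ∑ i, fderiv ℝ (fun x => fderiv ℝ φ x
      (EuclideanSpace.basisFun (Fin 3) ℝ i)) x (EuclideanSpace.basisFun (Fin 3) ℝ i) :=
    funext fun x => hφ.laplacian_eq _ x
  rw [h]
  simp only [Fin.sum_univ_three]
  exact (((hφ.fderiv_apply _).fderiv_apply _).2.add ((hφ.fderiv_apply _).fderiv_apply _).2).add
    ((hφ.fderiv_apply _).fderiv_apply _).2

theorem locallyIntegrable_radialField {b : ℝ → ℝ} (hbc : Continuous b)
    (hb : ∀ s, 0 ≤ s → |b s| ≤ 1) : LocallyIntegrable (radialField b) :=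
  locallyIntegrable_inv_norm_sq.mono (measurable_radialField hbc).aestronglyMeasurable
    (ae_of_all _ fun x => by
      rw [norm_inv, norm_pow, norm_norm]; exact norm_flux_smul_le_inv_sq hb le_rfl)

theorem locallyIntegrable_comp_sub {F : Type*} [NormedAddCommGroup F] {L : E3 → F}
    (hL : LocallyIntegrable L) (y : E3) : LocallyIntegrable fun z => L (z - y) := by
  rw [locallyIntegrable_iff] at hL ⊢
  intro k hk
  have h := hL ((fun z => z - y) '' k) (hk.image (by fun_prop))
  exact ((measurePreserving_sub_right volume y).integrableOn_image
    (Homeomorph.subRight y).measurableEmbedding).1 h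

theorem integral_profile_sub_mul_fderiv {g b : ℝ → ℝ}
    (hg : ∀ s, 0 < s → HasDerivAt g (b s / s ^ 2) s) (hb : Continuous b)
    (hb1 : ∀ s, 0 ≤ s → |b s| ≤ 1) (hg1 : ∀ s, 0 ≤ s → |g s| ≤ s⁻¹)
    {φ : E3 → ℝ} (hφ : IsTest φ) (v y : E3) :
    ∫ z, g ‖z - y‖ * fderiv ℝ φ z v = -∫ z, inner ℝ (radialField b (z - y)) v * φ z := by
  have h := integral_profile_mul_fderiv hg hb hb1 hg1 (φ := fun z => φ (z + y))
    (by have := hφ.contDiff 1; fun_prop) (hφ.2.comp_homeomorph (Homeomorph.addRight y)) v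
  simp_rw [fderiv_comp_add_right] at h
  rw [← integral_add_right_eq_self (fun z => g ‖z - y‖ * fderiv ℝ φ z v) y,
    ← integral_add_right_eq_self (fun z => inner ℝ (radialField b (z - y)) v * φ z) y]
  simpa using h

/-- The Laplacian is a sum of second partial derivatives, and each coordinate admits one integration
by parts with a first partial derivative of φ as test function. -/
theorem integral_profile_sub_mul_laplacian {g b : ℝ → ℝ}
    (hg : ∀ s, 0 < s → HasDerivAt g (b s / s ^ 2) s) (hb : Continuous b) (hgm : Measurable g)
    (hb1 : ∀ s, 0 ≤ s → |b s| ≤ 1) (hg1 : ∀ s, 0 ≤ s → |g s| ≤ s⁻¹)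
    {φ : E3 → ℝ} (hφ : IsTest φ) (y : E3) :
    ∫ z, g ‖z - y‖ * Δ φ z = -∫ z, inner ℝ (radialField b (z - y)) (∇ φ z) := by
  set e := EuclideanSpace.basisFun (Fin 3) ℝ
  have hgl : LocallyIntegrable fun z : E3 => g ‖z - y‖ := by
    refine locallyIntegrable_comp_sub (L := fun z => g ‖z‖) ?_ y
    exact locallyIntegrable_inv_norm.mono (hgm.comp measurable_norm).aestronglyMeasurable
      (ae_of_all _ fun x => by rw [norm_inv, norm_norm]; exact hg1 _ (norm_nonneg x))
  have hbl := locallyIntegrable_comp_sub (locallyIntegrable_radialField hb hb1) y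
  have e1 : ∀ z, g ‖z - y‖ * Δ φ z
      = ∑ i, g ‖z - y‖ * fderiv ℝ (fun x => fderiv ℝ φ x (e i)) z (e i) := fun z => by
    rw [hφ.laplacian_eq e, Finset.mul_sum]
  have e2 : ∀ z, inner ℝ (radialField b (z - y)) (∇ φ z)
      = ∑ i, inner ℝ (radialField b (z - y)) (e i) * fderiv ℝ φ z (e i) := fun z => by
    rw [← e.sum_inner_mul_inner]
    refine Finset.sum_congr rfl fun i _ => ?_
    rw [real_inner_comm (∇ φ z) (e i), inner_gradient_eq]
  simp_rw [e1, e2]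
  rw [integral_finsetSum, integral_finsetSum, ← Finset.sum_neg_distrib]
  · exact Finset.sum_congr rfl fun i _ =>
      integral_profile_sub_mul_fderiv hg hb hb1 hg1 (hφ.fderiv_apply (e i)) (e i) y
  · intro i _
    have h := (hbl.integrable_smul_left_of_hasCompactSupport (hφ.fderiv_apply (e i)).1.continuous
      (hφ.fderiv_apply (e i)).2).inner_const (𝕜 := ℝ) (e i)
    refine h.congr (ae_of_all _ fun z => ?_)
    simp [inner_smul_left, mul_comm]
  · intro i _
    have h2 := (hφ.fderiv_apply (e i)).fderiv_apply (e i)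
    have h := hgl.integrable_smul_left_of_hasCompactSupport h2.1.continuous h2.2
    refine h.congr (ae_of_all _ fun z => ?_)
    simp [mul_comm]

theorem integral_inner_radialField_gradient {b b' : ℝ → ℝ}
    (hb : ∀ r, HasDerivAt b (b' r) r) (hb1 : ∀ s, 0 ≤ s → |b s| ≤ 1)
    (hl : LocallyIntegrable fun x : E3 => b' ‖x‖ / ‖x‖ ^ 2) {φ : E3 → ℝ} (hφ : IsTest φ) (y : E3) :
    ∫ z, inner ℝ (radialField b (z - y)) (∇ φ z)
      = -(∫ z, b' ‖z - y‖ / ‖z - y‖ ^ 2 * φ z) - 4 * Real.pi * (b 0 * φ y) := by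
  have hbc : Continuous b := continuous_iff_continuousAt.2 fun r => (hb r).continuousAt
  have hs := (hφ.2.comp_homeomorph (Homeomorph.addRight y))
  have hs' := (hφ.hasCompactSupport_gradient.comp_homeomorph (Homeomorph.addRight y))
  have hi1 : Integrable fun x => inner ℝ (radialField b x) (∇ φ (x + y)) := by
    have hn := locallyIntegrable_inv_norm_sq.integrable_smul_left_of_hasCompactSupport
      (g := fun x => ‖∇ φ (x + y)‖) (hφ.continuous_gradient.comp (by fun_prop)).norm hs'.norm
    refine hn.mono' ?_ (ae_of_all _ fun z => ?_)
    · exact (measurable_radialField hbc).aestronglyMeasurable.inner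
        (hφ.continuous_gradient.comp (by fun_prop)).aestronglyMeasurable
    · refine (norm_inner_le_norm _ _).trans ?_
      rw [smul_eq_mul, mul_comm]
      gcongr
      exact norm_flux_smul_le_inv_sq hb1 le_rfl
  have hi2 : Integrable fun x : E3 => b' ‖x‖ / ‖x‖ ^ 2 * φ (x + y) := by
    have hn := hl.integrable_smul_left_of_hasCompactSupport
      (g := fun x => φ (x + y)) (hφ.1.continuous.comp (by fun_prop)) hs
    refine hn.congr (ae_of_all _ fun z => ?_)
    simp [mul_comm]
  have h := integral_inner_radialField (Φ := fun z => φ (z + y)) (G := fun z => ∇ φ (z + y))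
    hb hb1 (fun x => ?_) ?_ hi1 hi2
  · rw [← integral_add_right_eq_self (fun z => inner ℝ (radialField b (z - y)) (∇ φ z)) y,
      ← integral_add_right_eq_self (fun z => b' ‖z - y‖ / ‖z - y‖ ^ 2 * φ z) y]
    simpa using h
  · have h := hφ.hasGradientAt (x + y)
    rw [hasGradientAt_iff_hasFDerivAt] at h ⊢
    exact (hasFDerivAt_comp_add_right y).2 h
  · exact hs.is_zero_at_infty

theorem fluxK_deriv_div {z : E3} : -(‖z‖ * Real.exp (-‖z‖)) / ‖z‖ ^ 2 = -yukawa z := by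
  rcases eq_or_ne z 0 with rfl | hz
  -- At z = 0 both sides vanish because division by zero yields 0.
  · simp [yukawa, profileY]
  · exact neg_mul_exp_div_eq hz

theorem fluxY_deriv_div {z : E3} : ‖z‖ * Real.exp (-‖z‖) / ‖z‖ ^ 2 = yukawa z := by
  rw [← neg_inj, ← neg_div]; exact fluxK_deriv_div

theorem locallyIntegrable_yukawa : LocallyIntegrable yukawa := integrable_yukawa.locallyIntegrable

theorem measurable_profileK : Measurable profileK := by unfold profileK; fun_prop

theorem measurable_profileY : Measurable profileY := by unfold profileY; fun_prop

/-- `∇K` is the distributional gradient of `K`. -/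
theorem integral_kernel_mul_fderiv {φ : E3 → ℝ} (hφ : IsTest φ) (v y : E3) :
    ∫ z, kernel (z - y) * fderiv ℝ φ z v = -∫ z, inner ℝ (gradK (z - y)) v * φ z :=
  integral_profile_sub_mul_fderiv hasDerivAt_profileK continuous_fluxK
    (fun _ => abs_fluxK_le_one) (fun _ => abs_profileK_le_inv) hφ v y

/-- The distributional Laplacian of `K` is minus the Yukawa kernel. -/
theorem integral_kernel_mul_laplacian {φ : E3 → ℝ} (hφ : IsTest φ) (y : E3) :
    ∫ z, kernel (z - y) * Δ φ z = -∫ z, yukawa (z - y) * φ z := by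
  have h1 := integral_profile_sub_mul_laplacian hasDerivAt_profileK continuous_fluxK
    measurable_profileK (fun _ => abs_fluxK_le_one) (fun _ => abs_profileK_le_inv) hφ y
  have h2 := integral_inner_radialField_gradient hasDerivAt_fluxK
    (fun _ => abs_fluxK_le_one) (by simp_rw [fluxK_deriv_div]; exact locallyIntegrable_yukawa.neg)
    hφ y
  rw [show fluxK 0 = 0 by simp [fluxK]] at h2
  simp_rw [fluxK_deriv_div] at h2
  simp only [neg_mul, integral_neg] at h2
  change ∫ z, profileK ‖z - y‖ * Δ φ z = _
  rw [h1, h2]; ring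

/-- The Yukawa kernel is `4 π` times the fundamental solution of `1 - Δ`. -/
theorem integral_yukawa_mul_sub_laplacian {φ : E3 → ℝ} (hφ : IsTest φ) (y : E3) :
    (∫ z, yukawa (z - y) * φ z) - ∫ z, yukawa (z - y) * Δ φ z = 4 * Real.pi * φ y := by
  have h1 := integral_profile_sub_mul_laplacian hasDerivAt_profileY continuous_fluxY
    measurable_profileY (fun _ => abs_fluxY_le_one) (fun _ => abs_profileY_le_inv) hφ y
  have h2 := integral_inner_radialField_gradient hasDerivAt_fluxY
    (fun _ => abs_fluxY_le_one) (by simp_rw [fluxY_deriv_div]; exact locallyIntegrable_yukawa)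
    hφ y
  rw [show fluxY 0 = -1 by simp [fluxY]] at h2
  simp_rw [fluxY_deriv_div] at h2
  have h3 : ∫ z, yukawa (z - y) * Δ φ z = ∫ z, profileY ‖z - y‖ * Δ φ z := rfl
  rw [h3, h1, h2]; ring

end TestFunctions

/-! ### Convolution of admissible functions with mild kernels -/

section Convolution

/-- The condition `∫ |f(y)| / (1 + |y|) dy < ∞`, under which `K * f` converges everywhere. -/
def IsAdmissible (f : E3 → ℝ) : Prop := Integrable fun y => (1 + ‖y‖)⁻¹ * f y

theorem IsAdmissible.aestronglyMeasurable {f : E3 → ℝ} (hf : IsAdmissible f) :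
    AEStronglyMeasurable f := by
  have h : AEStronglyMeasurable (fun y : E3 => (1 + ‖y‖) * ((1 + ‖y‖)⁻¹ * f y)) :=
    (by fun_prop : Continuous fun y : E3 => 1 + ‖y‖).aestronglyMeasurable.mul
      (Integrable.aestronglyMeasurable hf)
  refine h.congr (ae_of_all _ fun y => ?_)
  simp only
  have : 0 < 1 + ‖y‖ := by positivity
  field_simp

theorem IsAdmissible.locallyIntegrable {f : E3 → ℝ} (hf : IsAdmissible f) :
    LocallyIntegrable f := by
  have h : LocallyIntegrable fun y : E3 => (1 + ‖y‖) • ((1 + ‖y‖)⁻¹ * f y) :=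
    (Integrable.locallyIntegrable hf).continuous_smul (by fun_prop)
  convert h using 2 with y
  have : 0 < 1 + ‖y‖ := by positivity
  simp only [smul_eq_mul]
  field_simp

/-- A Peetre-type inequality: the weight moves from z - y to y at a cost depending on z only. -/
theorem inv_one_add_norm_sub_le (z y : E3) :
    (1 + ‖z - y‖)⁻¹ ≤ (1 + ‖z‖) * (1 + ‖y‖)⁻¹ := by
  have h : ‖y‖ ≤ ‖z‖ + ‖z - y‖ := by
    have := norm_sub_le z (z - y)
    rwa [sub_sub_cancel] at this
  rw [← div_eq_mul_inv, inv_eq_one_div, div_le_div_iff₀ (by positivity) (by positivity)]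
  nlinarith [norm_nonneg z, norm_nonneg (z - y)]

variable {F : Type*} [NormedAddCommGroup F] [NormedSpace ℝ F] [MeasurableSpace F] [BorelSpace F]
  [SecondCountableTopology F]

/-- The convolution `∫ f(y) L(z - y) dy`. -/
noncomputable def conv (L : E3 → F) (f : E3 → ℝ) (z : E3) : F := ∫ y, f y • L (z - y)

/-- Kernels which decay like `|x|⁻¹`, and whose singularities are integrable. -/
def IsMildKernel (L : E3 → F) : Prop :=
  Measurable L ∧ ∃ (A : ℝ) (p : E3 → ℝ), 0 ≤ A ∧ Integrable p ∧
    ∀ x, ‖L x‖ ≤ (1 + ‖x‖)⁻¹ * (A + p x)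

theorem isMildKernel_kernel : IsMildKernel kernel :=
  ⟨measurable_kernel, 2, 0, by norm_num, integrable_zero _ _ _, fun x => by
    rw [Real.norm_eq_abs, abs_of_nonneg (kernel_nonneg x), kernel_eq, mul_comm]
    simpa using profileK_le (norm_nonneg x)⟩

theorem norm_gradK_le_inv (x : E3) : ‖gradK x‖ ≤ 4 * (1 + ‖x‖)⁻¹ := by
  refine (norm_gradK_le x).trans ?_
  rw [← div_eq_mul_inv, ← div_eq_mul_inv, div_le_div_iff₀ (by positivity) (by positivity)]
  nlinarith [sq_nonneg (‖x‖ - 1), sq_nonneg ‖x‖]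

theorem isMildKernel_gradK : IsMildKernel gradK :=
  ⟨measurable_gradK, 4, 0, by norm_num, integrable_zero _ _ _, fun x => by
    rw [mul_comm]; simpa using norm_gradK_le_inv x⟩

theorem isMildKernel_yukawa : IsMildKernel yukawa :=
  ⟨measurable_yukawa, 0, fun x => (1 + ‖x‖) * yukawa x, le_rfl, integrable_one_add_norm_mul_yukawa,
    fun x => by
      have : 0 < 1 + ‖x‖ := by positivity
      rw [Real.norm_eq_abs, abs_of_nonneg (yukawa_nonneg x), zero_add, inv_mul_cancel_left₀ this.ne']⟩

/-- The Fubini hypothesis for all pairings below. Once the weight is moved onto f, the part with A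
is a product of integrable functions of separate variables, and the part with p is the integrand of
a convolution of two L¹ functions. -/
theorem IsMildKernel.integrable_prod {L : E3 → F} (hL : IsMildKernel L) {f h : E3 → ℝ}
    (hf : IsAdmissible f) (hh : AEStronglyMeasurable h) {C R : ℝ} (hC : ∀ z, |h z| ≤ C)
    (hR : ∀ z, R ≤ ‖z‖ → h z = 0) :
    Integrable (fun q : E3 × E3 => (h q.1 * f q.2) • L (q.1 - q.2)) (volume.prod volume) := by
  obtain ⟨hLm, A, p, hA, hp, hLp⟩ := hL
  have hC0 : 0 ≤ C := (abs_nonneg _).trans (hC 0)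
  set w : E3 → ℝ := fun y => (1 + ‖y‖)⁻¹ * f y
  have hw : Integrable w := hf
  set H : E3 → ℝ := (Metric.ball (0 : E3) R).indicator fun _ => C * (1 + |R|)
  have hH : Integrable H := (integrableOn_const measure_ball_lt_top.ne).integrable_indicator
    measurableSet_ball
  have hhH : ∀ z, (1 + ‖z‖) * |h z| ≤ H z := by
    intro z
    by_cases hz : z ∈ Metric.ball (0 : E3) R
    · rw [show H z = C * (1 + |R|) from indicator_of_mem hz _, mul_comm C]
      have : ‖z‖ ≤ |R| := (le_of_lt (by simpa using hz)).trans (le_abs_self R)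
      gcongr
      exact hC z
    · rw [show H z = 0 from indicator_of_notMem hz _, hR z (by simpa using hz)]
      simp
  have hHC : ∀ z, H z ≤ C * (1 + |R|) := fun z => by
    refine indicator_le_self' (fun _ _ => by positivity) z |>.trans le_rfl
  have hH0 : ∀ z, 0 ≤ H z := fun z => (by positivity : 0 ≤ (1 + ‖z‖) * |h z|).trans (hhH z)
  have i1 : Integrable (fun q : E3 × E3 => A * (H q.1 * ‖w q.2‖)) (volume.prod volume) :=
    (hH.mul_prod hw.norm).const_mul A
  have i2 : Integrable (fun q : E3 × E3 => C * (1 + |R|) * (‖w q.2‖ * ‖p (q.1 - q.2)‖))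
      (volume.prod volume) :=
    (hw.norm.convolution_integrand (ContinuousLinearMap.mul ℝ ℝ) hp.norm).const_mul _
  refine (i1.add i2).mono' ?_ (ae_of_all _ fun q => ?_)
  · refine (hh.comp_fst.mul hf.aestronglyMeasurable.comp_snd).smul ?_
    exact (hLm.comp (by fun_prop)).aestronglyMeasurable
  · rw [norm_smul, norm_mul, Real.norm_eq_abs, Pi.add_apply]
    have hw' : ‖w q.2‖ = (1 + ‖q.2‖)⁻¹ * ‖f q.2‖ := by
      simp only [w]
      rw [norm_mul, Real.norm_eq_abs ((1 + ‖q.2‖)⁻¹), abs_of_nonneg (by positivity)]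
    have hAp : 0 ≤ A + ‖p (q.1 - q.2)‖ := by positivity
    calc |h q.1| * ‖f q.2‖ * ‖L (q.1 - q.2)‖
        ≤ |h q.1| * ‖f q.2‖ * ((1 + ‖q.1 - q.2‖)⁻¹ * (A + ‖p (q.1 - q.2)‖)) := by
          gcongr
          refine (hLp _).trans ?_
          gcongr
          exact Real.le_norm_self _
      _ ≤ |h q.1| * ‖f q.2‖ * (((1 + ‖q.1‖) * (1 + ‖q.2‖)⁻¹) * (A + ‖p (q.1 - q.2)‖)) := by
          gcongr
          exact inv_one_add_norm_sub_le _ _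
      _ = ((1 + ‖q.1‖) * |h q.1|) * ‖w q.2‖ * (A + ‖p (q.1 - q.2)‖) := by rw [hw']; ring
      _ ≤ H q.1 * ‖w q.2‖ * (A + ‖p (q.1 - q.2)‖) := by
          gcongr
          exact hhH _
      _ = A * (H q.1 * ‖w q.2‖) + H q.1 * (‖w q.2‖ * ‖p (q.1 - q.2)‖) := by ring
      _ ≤ _ := by
          gcongr
          exact hHC _

theorem IsMildKernel.ae_integrable {L : E3 → F} (hL : IsMildKernel L) {f : E3 → ℝ}
    (hf : IsAdmissible f) : ∀ᵐ z, Integrable fun y => f y • L (z - y) := by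
  have h : ∀ n : ℕ, ∀ᵐ z, z ∈ Metric.ball (0 : E3) n → Integrable fun y => f y • L (z - y) := by
    intro n
    have := (hL.integrable_prod hf (h := (Metric.ball (0 : E3) n).indicator 1)
      ((measurable_one.indicator measurableSet_ball).aestronglyMeasurable) (C := 1) (R := n)
      (fun z => by by_cases hz : z ∈ Metric.ball (0 : E3) n <;> simp [hz])
      (fun z hz => indicator_of_notMem (by simpa using hz) _)).prod_right_ae
    filter_upwards [this] with z hz hzn
    simpa [indicator_of_mem hzn] using hz
  filter_upwards [ae_all_iff.2 h] with z hz
  obtain ⟨n, hn⟩ := exists_nat_gt ‖z‖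
  exact hz n (by simpa using hn)

theorem IsMildKernel.locallyIntegrable_conv {L : E3 → F} (hL : IsMildKernel L)
    {f : E3 → ℝ} (hf : IsAdmissible f) : LocallyIntegrable (conv L f) := by
  rw [locallyIntegrable_iff]
  intro k hk
  obtain ⟨R, hR⟩ := hk.isBounded.subset_ball 0
  refine IntegrableOn.mono_set ?_ hR
  have := (hL.integrable_prod hf (h := (Metric.ball (0 : E3) R).indicator 1)
      ((measurable_one.indicator measurableSet_ball).aestronglyMeasurable) (C := 1) (R := R)
      (fun z => by by_cases hz : z ∈ Metric.ball (0 : E3) R <;> simp [hz])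
      (fun z hz => indicator_of_notMem (by simpa using hz) _)).integral_prod_left
  rw [← integrable_indicator_iff measurableSet_ball]
  refine this.congr (ae_of_all _ fun z => ?_)
  by_cases hz : z ∈ Metric.ball (0 : E3) R
  · simp [indicator_of_mem hz, conv]
  · simp [indicator_of_notMem hz]

theorem IsMildKernel.integrable_mul_integral {L : E3 → F} (hL : IsMildKernel L)
    {f h : E3 → ℝ} (hf : IsAdmissible f) (hc : Continuous h) (hs : HasCompactSupport h) :
    Integrable fun y => f y • ∫ z, h z • L (z - y) := by
  obtain ⟨C, hC⟩ := hs.exists_bound_of_continuous hc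
  obtain ⟨R, hR⟩ := hs.isCompact.isBounded.subset_ball 0
  have := (hL.integrable_prod hf hc.aestronglyMeasurable hC (R := R)
    (fun z hz => by
      by_contra h0
      have := hR (subset_tsupport _ h0)
      simp only [Metric.mem_ball, dist_zero_right] at this
      linarith)).integral_prod_right
  refine this.congr (ae_of_all _ fun y => ?_)
  simp only
  rw [← integral_smul]
  congr 1 with z
  rw [smul_smul, mul_comm]

/-- Transfers a distributional identity for the translates of L to the convolution of L with f. -/
theorem IsMildKernel.integral_smul_conv {L : E3 → F} (hL : IsMildKernel L)
    {f h : E3 → ℝ} (hf : IsAdmissible f) (hc : Continuous h) (hs : HasCompactSupport h) :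
    ∫ z, h z • conv L f z = ∫ y, f y • ∫ z, h z • L (z - y) := by
  obtain ⟨C, hC⟩ := hs.exists_bound_of_continuous hc
  obtain ⟨R, hR⟩ := hs.isCompact.isBounded.subset_ball 0
  have := integral_integral_swap (f := fun z y => (h z * f y) • L (z - y))
    (hL.integrable_prod hf hc.aestronglyMeasurable hC (R := R)
    (fun z hz => by
      by_contra h0
      have := hR (subset_tsupport _ h0)
      simp only [Metric.mem_ball, dist_zero_right] at this
      linarith))
  simp_rw [conv, ← integral_smul, smul_smul]
  rw [this]
  simp_rw [mul_comm]

end Convolution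

/-! ### Weak derivatives of the potential and the weak equation -/

section WeakDerivatives

variable {f : E3 → ℝ}

theorem potential_eq_conv (f : E3 → ℝ) : potential f = conv kernel f := by
  ext x; simp only [potential, conv, smul_eq_mul, mul_comm]

/-- Fubini moves the test function onto the translates of K, whose distributional gradient is known.
The vector identity is checked against each fixed direction v. -/
theorem IsAdmissible.hasWeakGradient (hf : IsAdmissible f) :
    HasWeakGradient (potential f) (conv gradK f) := by
  rw [potential_eq_conv]
  have hl := isMildKernel_kernel.locallyIntegrable_conv hf
  have hg := isMildKernel_gradK.locallyIntegrable_conv hf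
  refine ⟨hl, hg, fun φ hφ => ?_⟩
  refine ext_inner_right ℝ fun v => ?_
  have hi1 : Integrable fun x => conv kernel f x • ∇ φ x :=
    hl.integrable_smul_right_of_hasCompactSupport hφ.continuous_gradient hφ.hasCompactSupport_gradient
  have hi2 : Integrable fun x => φ x • conv gradK f x :=
    hg.integrable_smul_left_of_hasCompactSupport hφ.1.continuous hφ.2
  have hd := hφ.fderiv_apply v
  rw [inner_neg_left, isMildKernel_gradK.integral_smul_conv hf hφ.1.continuous hφ.2,
    real_inner_comm, ← integral_inner hi1, real_inner_comm, ← integral_inner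
      (isMildKernel_gradK.integrable_mul_integral hf hφ.1.continuous hφ.2), ← integral_neg]
  have e1 : ∀ x, inner ℝ v (conv kernel f x • ∇ φ x) = fderiv ℝ φ x v • conv kernel f x := by
    intro x
    rw [inner_smul_right, real_inner_comm, inner_gradient_eq, smul_eq_mul, mul_comm]
  simp_rw [e1]
  rw [isMildKernel_kernel.integral_smul_conv hf hd.1.continuous hd.2]
  congr 1 with y
  have hgi : Integrable fun z => φ z • gradK (z - y) :=
    (locallyIntegrable_comp_sub (locallyIntegrable_radialField continuous_fluxK
      (fun _ => abs_fluxK_le_one)) y).integrable_smul_left_of_hasCompactSupport hφ.1.continuous hφ.2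
  rw [inner_smul_right, ← integral_inner hgi, smul_eq_mul, ← mul_neg]
  congr 1
  have := integral_kernel_mul_fderiv hφ v y
  simp_rw [smul_eq_mul, mul_comm (fderiv ℝ φ _ v), this]
  congr 1
  congr 1 with z
  rw [inner_smul_right, real_inner_comm, mul_comm]

theorem IsAdmissible.hasWeakLaplacian (hf : IsAdmissible f) :
    HasWeakLaplacian (potential f) (-conv yukawa f) := by
  rw [potential_eq_conv]
  refine ⟨isMildKernel_kernel.locallyIntegrable_conv hf,
    (isMildKernel_yukawa.locallyIntegrable_conv hf).neg, fun φ hφ => ?_⟩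
  have h1 := isMildKernel_kernel.integral_smul_conv hf hφ.continuous_laplacian
    hφ.hasCompactSupport_laplacian
  have h2 := isMildKernel_yukawa.integral_smul_conv hf hφ.1.continuous hφ.2
  simp only [smul_eq_mul] at h1 h2
  simp only [Pi.neg_apply, mul_neg, integral_neg]
  rw [h2, ← integral_neg]
  simp_rw [mul_comm (conv kernel f _)]
  rw [h1]
  congr 1 with y
  rw [← mul_neg]
  congr 1
  have := integral_kernel_mul_laplacian hφ y
  simp_rw [mul_comm (Δ φ _), this, mul_comm]

/-- The definition of the weak gradient is applied to each partial derivative of φ, and the matching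
components are summed. -/
theorem HasWeakGradient.integral_inner_gradient {u : E3 → ℝ} {G : E3 → E3}
    (h : HasWeakGradient u G) {φ : E3 → ℝ} (hφ : IsTest φ) :
    ∫ x, inner ℝ (G x) (∇ φ x) = -∫ x, u x * Δ φ x := by
  set e := EuclideanSpace.basisFun (Fin 3) ℝ
  have hu : ∀ i, Integrable fun x => u x • ∇ (fun x => fderiv ℝ φ x (e i)) x := fun i =>
    h.1.integrable_smul_right_of_hasCompactSupport (hφ.fderiv_apply (e i)).continuous_gradient
      (hφ.fderiv_apply (e i)).hasCompactSupport_gradient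
  have hG : ∀ i, Integrable fun x => fderiv ℝ φ x (e i) • G x := fun i =>
    h.2.1.integrable_smul_left_of_hasCompactSupport (hφ.fderiv_apply (e i)).1.continuous
      (hφ.fderiv_apply (e i)).2
  have e1 : ∀ x, u x * Δ φ x
      = ∑ i, inner ℝ (e i) (u x • ∇ (fun x => fderiv ℝ φ x (e i)) x) := fun x => by
    rw [hφ.laplacian_eq e, Finset.mul_sum]
    refine Finset.sum_congr rfl fun i _ => ?_
    rw [inner_smul_right, real_inner_comm, inner_gradient_eq]
  have e2 : ∀ x, inner ℝ (G x) (∇ φ x) = ∑ i, inner ℝ (e i) (fderiv ℝ φ x (e i) • G x) := fun x => by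
    rw [← e.sum_inner_mul_inner]
    refine Finset.sum_congr rfl fun i _ => ?_
    rw [real_inner_comm (∇ φ x) (e i), inner_gradient_eq, inner_smul_right, real_inner_comm, mul_comm]
  simp_rw [e1, e2]
  rw [integral_finsetSum _ fun i _ => (hG i).const_inner (e i),
    integral_finsetSum _ fun i _ => (hu i).const_inner (e i), ← Finset.sum_neg_distrib]
  refine Finset.sum_congr rfl fun i _ => ?_
  rw [integral_inner (hG i), integral_inner (hu i), h.2.2 _ (hφ.fderiv_apply (e i)), inner_neg_right,
    neg_neg]

/-- The weak form of `-Δψ + Δ²ψ = 4πf`. -/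
theorem IsAdmissible.weak_equation (hf : IsAdmissible f) {φ : E3 → ℝ} (hφ : IsTest φ) :
    ∫ x, (inner ℝ (conv gradK f x) (∇ φ x) + (-conv yukawa f x) * Δ φ x)
      = 4 * Real.pi * ∫ x, f x * φ x := by
  have hg := isMildKernel_gradK.locallyIntegrable_conv hf
  have hy := isMildKernel_yukawa.locallyIntegrable_conv hf
  have hi1 : Integrable fun x => inner ℝ (conv gradK f x) (∇ φ x) := by
    have : Integrable fun x => ‖∇ φ x‖ • conv gradK f x :=
      hg.integrable_smul_left_of_hasCompactSupport hφ.continuous_gradient.norm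
        hφ.hasCompactSupport_gradient.norm
    refine this.mono (hg.aestronglyMeasurable.inner hφ.continuous_gradient.aestronglyMeasurable)
      (ae_of_all _ fun x => ?_)
    rw [norm_smul, norm_norm, mul_comm]
    exact norm_inner_le_norm _ _
  have hi2 : Integrable fun x => Δ φ x • conv yukawa f x :=
    hy.integrable_smul_left_of_hasCompactSupport hφ.continuous_laplacian
      hφ.hasCompactSupport_laplacian
  have hi2' : Integrable fun x => (-conv yukawa f x) * Δ φ x := by
    refine hi2.neg.congr (ae_of_all _ fun x => ?_)
    simp [mul_comm]
  -- The gradient term becomes -∫ ψΔφ = ∫ (Y*f)φ, so the left side is ∫ (Y*f)(φ - Δφ), to which the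
  -- fundamental solution property of Y applies.
  rw [integral_add hi1 hi2', hf.hasWeakGradient.integral_inner_gradient hφ,
    hf.hasWeakLaplacian.2.2 φ hφ]
  have h1 := isMildKernel_yukawa.integral_smul_conv hf hφ.1.continuous hφ.2
  have h2 := isMildKernel_yukawa.integral_smul_conv hf hφ.continuous_laplacian
    hφ.hasCompactSupport_laplacian
  have k1 := isMildKernel_yukawa.integrable_mul_integral hf hφ.1.continuous hφ.2
  have k2 := isMildKernel_yukawa.integrable_mul_integral hf hφ.continuous_laplacian
    hφ.hasCompactSupport_laplacian
  simp only [smul_eq_mul] at h1 h2 k1 k2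
  simp only [Pi.neg_apply, mul_neg, integral_neg, neg_neg, neg_mul]
  simp_rw [mul_comm (conv yukawa f _)]
  rw [h1, h2, ← sub_eq_add_neg, ← integral_sub k1 k2, ← integral_const_mul]
  congr 1 with y
  have h3 := integral_yukawa_mul_sub_laplacian hφ y
  simp_rw [mul_comm (yukawa _)] at h3
  rw [← mul_sub, h3]; ring

end WeakDerivatives

/-! ### Finite energy and the energy identity -/

section Energy

/-- Absolute convergence of the double integral of `K(x - y) f(x) g(y)`. -/
def FiniteEnergy (f g : E3 → ℝ) : Prop :=
  Integrable (fun q : E3 × E3 => kernel (q.1 - q.2) * (f q.1 * g q.2)) (volume.prod volume)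

/-- The kernel identities hold only off the diagonal, which is a null set. -/
theorem ae_ne_prod : ∀ᵐ q : E3 × E3 ∂(volume.prod volume), q.1 ≠ q.2 := by
  rw [ae_iff]
  simp only [ne_eq, not_not]
  rw [Measure.measure_prod_null (measurableSet_eq_fun measurable_fst measurable_snd)]
  refine ae_of_all _ fun x => ?_
  have : Prod.mk x ⁻¹' {q : E3 × E3 | q.1 = q.2} = {x} := by ext y; simp [eq_comm]
  exact (congrArg volume this).trans (by simp)

theorem aestronglyMeasurable_kernel_mul {f g : E3 → ℝ} (hf : AEStronglyMeasurable f)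
    (hg : AEStronglyMeasurable g) :
    AEStronglyMeasurable (fun q : E3 × E3 => kernel (q.1 - q.2) * (f q.1 * g q.2))
      (volume.prod volume) :=
  ((measurable_kernel.comp (by fun_prop : Measurable fun q : E3 × E3 =>
    q.1 - q.2)).aestronglyMeasurable).mul (hf.comp_fst.mul hg.comp_snd)

theorem energy_abs_eq {f g : E3 → ℝ} (hf : AEMeasurable f) (hg : AEMeasurable g) :
    energy (fun x => ENNReal.ofReal |f x|) (fun x => ENNReal.ofReal |g x|)
      = ∫⁻ q : E3 × E3, ‖kernel (q.1 - q.2) * (f q.1 * g q.2)‖ₑ ∂(volume.prod volume) := by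
  rw [lintegral_prod _ (aestronglyMeasurable_kernel_mul hf.aestronglyMeasurable
    hg.aestronglyMeasurable).enorm, energy]
  congr 1 with x
  congr 1 with y
  rw [enorm_mul, enorm_mul, mul_assoc]
  simp only [Real.enorm_eq_ofReal_abs, abs_of_nonneg (kernel_nonneg _)]

theorem energy_abs_lt_top_iff {f g : E3 → ℝ} (hf : AEMeasurable f) (hg : AEMeasurable g) :
    energy (fun x => ENNReal.ofReal |f x|) (fun x => ENNReal.ofReal |g x|) < ⊤
      ↔ FiniteEnergy f g := by
  rw [energy_abs_eq hf hg, FiniteEnergy, Integrable, HasFiniteIntegral]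
  exact ⟨fun h => ⟨aestronglyMeasurable_kernel_mul hf.aestronglyMeasurable
    hg.aestronglyMeasurable, h⟩, fun h => h.2⟩

theorem FiniteEnergy.mono {f g f' g' : E3 → ℝ} (h : FiniteEnergy f g)
    (hf' : AEStronglyMeasurable f') (hg' : AEStronglyMeasurable g')
    (hf : ∀ᵐ x, |f' x| ≤ |f x|) (hg : ∀ᵐ x, |g' x| ≤ |g x|) : FiniteEnergy f' g' := by
  refine Integrable.mono h (aestronglyMeasurable_kernel_mul hf' hg') ?_
  filter_upwards [Measure.quasiMeasurePreserving_fst.ae hf,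
    Measure.quasiMeasurePreserving_snd.ae hg] with q h1 h2
  simp only [norm_mul, Real.norm_eq_abs]
  gcongr

/-- One point x suffices: for y ≠ x, (1+|y|)⁻¹ is at most (1+|x|) K(x-y). -/
theorem isAdmissible_of_integrable_kernel {f : E3 → ℝ} (hf : AEStronglyMeasurable f) {x : E3}
    (h : Integrable fun y => kernel (x - y) * f y) : IsAdmissible f := by
  refine (h.norm.const_mul (1 + ‖x‖)).mono' ?_ ?_
  · exact (by fun_prop : Measurable fun y : E3 => (1 + ‖y‖)⁻¹).aestronglyMeasurable.mul hf
  · filter_upwards [(by simp [ae_iff] : ∀ᵐ y : E3, y ≠ x)] with y hy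
    have hy0 : (0 : ℝ) ≤ (1 + ‖y‖)⁻¹ := by positivity
    rw [norm_mul, norm_mul, Real.norm_of_nonneg hy0, Real.norm_of_nonneg (kernel_nonneg _),
      ← mul_assoc]
    gcongr
    have h1 := inv_one_add_norm_sub_le x (x - y)
    rw [sub_sub_cancel] at h1
    refine h1.trans ?_
    gcongr
    exact inv_le_profileK (norm_pos_iff.2 (sub_ne_zero.2 hy.symm))

/-- Unless f vanishes almost everywhere, Fubini supplies a point x with f(x) ≠ 0 at which y ↦ K(x-y)
f(x) f(y) is integrable; then f(x) is divided out. -/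
theorem FiniteEnergy.isAdmissible {f : E3 → ℝ} (hf : AEStronglyMeasurable f)
    (h : FiniteEnergy f f) : IsAdmissible f := by
  by_cases h0 : f =ᵐ[volume] 0
  · refine (integrable_zero E3 ℝ volume).congr ?_
    filter_upwards [h0] with y hy
    simp [hy]
  · have h1 := Integrable.prod_right_ae h
    obtain ⟨x, hx0, hx⟩ : ∃ x, f x ≠ 0 ∧
        Integrable fun y => kernel (x - y) * (f x * f y) := by
      by_contra hcon
      push Not at hcon
      refine h0 ?_
      filter_upwards [h1] with x hx
      by_contra h2
      exact hcon x h2 hx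
    refine isAdmissible_of_integrable_kernel hf (x := x) ?_
    refine (hx.const_mul (f x)⁻¹).congr (ae_of_all _ fun y => ?_)
    simp only
    field_simp

theorem IsAdmissible.integrable_kernel {f : E3 → ℝ} (hf : IsAdmissible f) (x : E3) :
    Integrable fun y => kernel (x - y) * f y := by
  refine (Integrable.norm hf |>.const_mul (2 * (1 + ‖x‖))).mono' ?_ (ae_of_all _ fun y => ?_)
  · exact (measurable_kernel.comp (by fun_prop)).aestronglyMeasurable.mul hf.aestronglyMeasurable
  · have hy0 : (0 : ℝ) ≤ (1 + ‖y‖)⁻¹ := by positivity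
    rw [norm_mul, norm_mul, Real.norm_of_nonneg hy0, Real.norm_of_nonneg (kernel_nonneg _),
      ← mul_assoc]
    gcongr
    refine (profileK_le (norm_nonneg _)).trans ?_
    rw [mul_assoc]
    gcongr
    exact inv_one_add_norm_sub_le x y

/-! ### Quadratic forms dominated by the energy -/

section Bilinear

variable {H : Type*} [NormedAddCommGroup H] [InnerProductSpace ℝ H] [MeasurableSpace H]
  [BorelSpace H] [SecondCountableTopology H]

/-- Kernels whose quadratic form is dominated by the energy. -/
def IsEnergyKernel (L : E3 → H) : Prop :=
  IsMildKernel L ∧ ∃ C : ℝ, ∀ x y : E3, x ≠ y →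
    Integrable (fun z => ‖L (z - x)‖ * ‖L (z - y)‖) ∧
    ∫ z, ‖L (z - x)‖ * ‖L (z - y)‖ ≤ C * kernel (x - y)

theorem isEnergyKernel_gradK : IsEnergyKernel gradK := by
  obtain ⟨C, hC⟩ := integral_norm_gradK_mul_le
  refine ⟨isMildKernel_gradK, C, fun x y hxy => ⟨(hC x y).1, (hC x y).2.trans ?_⟩⟩
  -- At x = y = 0 the bound reads: a nonnegative integral is at most C.
  have hC0 : 0 ≤ C := by
    have h1 := (hC 0 0).2
    have h2 : 0 ≤ ∫ z : E3, ‖gradK (z - 0)‖ * ‖gradK (z - 0)‖ :=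
      integral_nonneg fun z => by positivity
    simpa using h2.trans h1
  gcongr
  exact inv_le_profileK (norm_pos_iff.2 (sub_ne_zero.2 hxy))

theorem isEnergyKernel_yukawa : IsEnergyKernel yukawa := by
  refine ⟨isMildKernel_yukawa, 4 * Real.pi, fun x y hxy => ?_⟩
  simp only [Real.norm_eq_abs, abs_of_nonneg (yukawa_nonneg _)]
  exact ⟨integrable_yukawa_mul_yukawa x y, integral_yukawa_mul_le hxy⟩

/-- Integrating the norm in z first leaves at most C |f(x) g(y)| K(x-y), which is integrable by
finite energy. -/
theorem IsEnergyKernel.integrable_triple {L : E3 → H} (hL : IsEnergyKernel L) {f g : E3 → ℝ}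
    (hf : AEStronglyMeasurable f) (hg : AEStronglyMeasurable g) (h : FiniteEnergy f g) :
    Integrable (fun p : (E3 × E3) × E3 =>
      inner ℝ (f p.1.1 • L (p.2 - p.1.1)) (g p.1.2 • L (p.2 - p.1.2)))
      ((volume.prod volume).prod volume) := by
  obtain ⟨⟨hLm, -⟩, C, hC⟩ := hL
  have hm : AEStronglyMeasurable (fun p : (E3 × E3) × E3 =>
      inner ℝ (f p.1.1 • L (p.2 - p.1.1)) (g p.1.2 • L (p.2 - p.1.2)))
      ((volume.prod volume).prod volume) := by
    refine AEStronglyMeasurable.inner ?_ ?_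
    · exact (hf.comp_fst (ν := volume)).comp_fst.smul
        (hLm.comp (by fun_prop)).aestronglyMeasurable
    · exact (hg.comp_snd (μ := volume)).comp_fst.smul
        (hLm.comp (by fun_prop)).aestronglyMeasurable
  have hle : ∀ (q : E3 × E3) (z : E3),
      ‖inner ℝ (f q.1 • L (z - q.1)) (g q.2 • L (z - q.2))‖
        ≤ ‖f q.1 * g q.2‖ * (‖L (z - q.1)‖ * ‖L (z - q.2)‖) := fun q z => by
    refine (norm_inner_le_norm _ _).trans (le_of_eq ?_)
    rw [norm_smul, norm_smul, norm_mul]; ring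
  have hin : ∀ q : E3 × E3, q.1 ≠ q.2 →
      Integrable fun z => inner ℝ (f q.1 • L (z - q.1)) (g q.2 • L (z - q.2)) := fun q hq => by
    refine ((hC q.1 q.2 hq).1.const_mul ‖f q.1 * g q.2‖).mono' ?_ (ae_of_all _ (hle q))
    exact ((hLm.comp (by fun_prop)).const_smul _).aestronglyMeasurable.inner
      ((hLm.comp (by fun_prop)).const_smul _).aestronglyMeasurable
  rw [integrable_prod_iff hm]
  refine ⟨?_, ?_⟩
  · filter_upwards [ae_ne_prod] with q hq using hin q hq
  · refine (Integrable.norm h |>.const_mul C).mono' hm.norm.integral_prod_right' ?_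
    filter_upwards [ae_ne_prod] with q hq
    rw [Real.norm_eq_abs, abs_of_nonneg (integral_nonneg fun z => norm_nonneg _)]
    calc _ ≤ ∫ z, ‖f q.1 * g q.2‖ * (‖L (z - q.1)‖ * ‖L (z - q.2)‖) :=
          integral_mono (hin q hq).norm ((hC q.1 q.2 hq).1.const_mul _) (hle q)
      _ ≤ ‖f q.1 * g q.2‖ * (C * kernel (q.1 - q.2)) := by
          rw [integral_const_mul]
          gcongr
          exact (hC q.1 q.2 hq).2
      _ = _ := by
          rw [norm_mul (kernel _), Real.norm_eq_abs (kernel _), abs_of_nonneg (kernel_nonneg _)]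
          ring

/-- The triple integral is evaluated in both orders. For almost every fixed z, the integral over (x,
y) factors into the inner product of the two convolutions. -/
theorem IsEnergyKernel.integral_inner_conv [CompleteSpace H] {L : E3 → H} (hL : IsEnergyKernel L)
    {f g : E3 → ℝ} (hf : IsAdmissible f) (hg : IsAdmissible g) (h : FiniteEnergy f g) :
    Integrable (fun z => inner ℝ (conv L f z) (conv L g z)) ∧
    Integrable (fun q : E3 × E3 => f q.1 * g q.2 * ∫ z : E3, inner ℝ (L (z - q.1)) (L (z - q.2)))
      (volume.prod volume) ∧
    ∫ z, inner ℝ (conv L f z) (conv L g z)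
      = ∫ q : E3 × E3, f q.1 * g q.2 * (∫ z : E3, inner ℝ (L (z - q.1)) (L (z - q.2)))
        ∂(volume.prod volume) := by
  have hT := hL.integrable_triple hf.aestronglyMeasurable hg.aestronglyMeasurable h
  have e1 : ∀ᵐ z : E3, ∫ q : E3 × E3, inner ℝ (f q.1 • L (z - q.1)) (g q.2 • L (z - q.2))
      ∂(volume.prod volume) = inner ℝ (conv L f z) (conv L g z) := by
    filter_upwards [hL.1.ae_integrable hf, hL.1.ae_integrable hg, hT.prod_left_ae] with z h1 h2 h3
    rw [integral_prod _ h3]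
    simp_rw [integral_inner h2]
    rw [conv, conv, real_inner_comm, ← integral_inner h1]
    simp_rw [real_inner_comm]
  have e2 : ∀ q : E3 × E3, ∫ z, inner ℝ (f q.1 • L (z - q.1)) (g q.2 • L (z - q.2))
      = f q.1 * g q.2 * ∫ z : E3, inner ℝ (L (z - q.1)) (L (z - q.2)) := fun q => by
    rw [← integral_const_mul]
    congr 1 with z
    rw [real_inner_smul_left, real_inner_smul_right]; ring
  refine ⟨hT.integral_prod_right.congr e1, ?_, ?_⟩
  · exact hT.integral_prod_left.congr (ae_of_all _ e2)
  · rw [← integral_congr_ae e1, ← integral_integral_swap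
      (f := fun (q : E3 × E3) z => inner ℝ (f q.1 • L (z - q.1)) (g q.2 • L (z - q.2))) hT]
    simp_rw [e2]

theorem IsEnergyKernel.memLp_conv [CompleteSpace H] {L : E3 → H} (hL : IsEnergyKernel L)
    {f : E3 → ℝ} (hf : IsAdmissible f) (h : FiniteEnergy f f) : MemLp (conv L f) 2 := by
  have h1 := (hL.integral_inner_conv hf hf h).1
  rw [memLp_two_iff_integrable_sq_norm (hL.1.locallyIntegrable_conv hf).aestronglyMeasurable]
  simpa only [real_inner_self_eq_norm_sq] using h1

end Bilinear

/-- The polarized energy identity. -/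
theorem integral_conv_eq_energy {f g : E3 → ℝ} (hf : IsAdmissible f) (hg : IsAdmissible g)
    (h : FiniteEnergy f g) :
    (∫ z, inner ℝ (conv gradK f z) (conv gradK g z)) + ∫ z, conv yukawa f z * conv yukawa g z
      = 4 * Real.pi * ∫ q : E3 × E3, kernel (q.1 - q.2) * (f q.1 * g q.2)
        ∂(volume.prod volume) := by
  obtain ⟨-, a2, a3⟩ := isEnergyKernel_gradK.integral_inner_conv hf hg h
  obtain ⟨-, b2, b3⟩ := isEnergyKernel_yukawa.integral_inner_conv hf hg h
  have e : ∀ a b : ℝ, inner ℝ a b = a * b := fun a b => by simp [mul_comm]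
  simp_rw [e] at b2 b3
  rw [a3, b3, ← integral_add a2 b2, ← integral_const_mul]
  refine integral_congr_ae ?_
  filter_upwards [ae_ne_prod] with q hq
  rw [← mul_add, integral_gradK_add_yukawa hq]; ring

theorem FiniteEnergy.integrable_mul {f g : E3 → ℝ} (h : FiniteEnergy f g) :
    Integrable (fun x => f x * potential g x) ∧
    ∫ x, f x * potential g x = ∫ q : E3 × E3, kernel (q.1 - q.2) * (f q.1 * g q.2)
        ∂(volume.prod volume) := by
  have e : ∀ x, ∫ y, kernel (x - y) * (f x * g y) = f x * potential g x := fun x => by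
    rw [potential, ← integral_const_mul]
    congr 1 with y; ring
  refine ⟨?_, ?_⟩
  · simpa only [e] using Integrable.integral_prod_left h
  · rw [integral_prod _ h]; simp_rw [e]

end Energy

/-! ### A C¹ soft threshold -/

section SoftThreshold

theorem hasDerivAt_max_zero_sq (t : ℝ) :
    HasDerivAt (fun t : ℝ => max t 0 ^ 2) (2 * max t 0) t := by
  rcases lt_trichotomy t 0 with ht | rfl | ht
  · rw [max_eq_right ht.le, mul_zero]
    refine (hasDerivAt_const t (0 : ℝ)).congr_of_eventuallyEq ?_
    filter_upwards [Iio_mem_nhds ht] with s hs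
    rw [max_eq_right (le_of_lt hs)]; simp
  · have h : (fun t : ℝ => max t 0 ^ 2) =O[𝓝 0] fun t : ℝ => ‖t - 0‖ ^ 2 := by
      refine Asymptotics.IsBigO.of_bound 1 (Eventually.of_forall fun s => ?_)
      rw [sub_zero, one_mul, norm_pow, norm_pow, norm_norm]
      gcongr
      rw [Real.norm_of_nonneg (le_max_right _ _)]
      exact max_le (le_abs_self s) (abs_nonneg s)
    have h2 := (h.hasFDerivAt (𝕜 := ℝ) (by norm_num)).hasDerivAt
    simpa using h2
  · rw [max_eq_left ht.le]
    have := hasDerivAt_pow 2 t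
    refine (this.congr_of_eventuallyEq ?_).congr_deriv (by simp)
    filter_upwards [Ioi_mem_nhds ht] with s hs
    rw [max_eq_left (le_of_lt hs)]

/-- A `C¹` approximation of the identity on `[0, ∞)` vanishing on `(-∞, δ]`. -/
noncomputable def softThreshold (δ t : ℝ) : ℝ := √(δ ^ 2 + max (t - δ) 0 ^ 2) - δ

theorem hasDerivAt_softThreshold {δ : ℝ} (hδ : 0 < δ) (t : ℝ) :
    HasDerivAt (softThreshold δ) (max (t - δ) 0 / √(δ ^ 2 + max (t - δ) 0 ^ 2)) t := by
  have h1 : HasDerivAt (fun t => δ ^ 2 + max (t - δ) 0 ^ 2) (2 * max (t - δ) 0) t :=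
    ((hasDerivAt_max_zero_sq (t - δ)).comp_sub_const t δ).const_add _
  refine ((h1.sqrt (by positivity)).sub_const δ).congr_deriv ?_
  field_simp

theorem contDiff_softThreshold {δ : ℝ} (hδ : 0 < δ) : ContDiff ℝ 1 (softThreshold δ) := by
  rw [contDiff_one_iff_deriv]
  refine ⟨fun t => (hasDerivAt_softThreshold hδ t).differentiableAt, ?_⟩
  rw [show deriv (softThreshold δ) = fun t => max (t - δ) 0 / √(δ ^ 2 + max (t - δ) 0 ^ 2) from
    funext fun t => (hasDerivAt_softThreshold hδ t).deriv]
  refine Continuous.div (by fun_prop) (by fun_prop) fun t => ?_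
  positivity

/-- Composition with the threshold therefore never increases a gradient, while
`softThreshold_eq_zero` turns decay at infinity into compact support. -/
theorem abs_deriv_softThreshold_le {δ : ℝ} (hδ : 0 < δ) (t : ℝ) :
    |deriv (softThreshold δ) t| ≤ 1 := by
  rw [(hasDerivAt_softThreshold hδ t).deriv, abs_div, abs_of_nonneg (le_max_right _ _),
    abs_of_nonneg (Real.sqrt_nonneg _)]
  exact div_le_one_of_le₀ (Real.le_sqrt_of_sq_le (by nlinarith)) (Real.sqrt_nonneg _)

theorem softThreshold_eq_zero {δ t : ℝ} (hδ : 0 < δ) (ht : t ≤ δ) : softThreshold δ t = 0 := by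
  rw [softThreshold, max_eq_right (by linarith)]
  simp [Real.sqrt_sq hδ.le]

theorem tendsto_softThreshold {δ v : ℕ → ℝ} {t : ℝ} (hδ : Tendsto δ atTop (𝓝 0))
    (hv : Tendsto v atTop (𝓝 t)) (ht : 0 ≤ t) :
    Tendsto (fun n => softThreshold (δ n) (v n)) atTop (𝓝 t) := by
  have h := (((hδ.pow 2).add (((hv.sub hδ).max (tendsto_const_nhds (x := (0 : ℝ)))).pow 2)).sqrt).sub hδ
  simpa [softThreshold, ht, Real.sqrt_sq ht] using h

end SoftThreshold

/-! ### Regularized potentials of integrable functions -/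

section SmoothedPotential

/-- A bound for the gradients of all regularizations of the kernel. -/
noncomputable def decayKernel (x : E3) : ℝ := 2 * (1 + ‖x‖ ^ 2)⁻¹

theorem decayKernel_nonneg (x : E3) : 0 ≤ decayKernel x := by unfold decayKernel; positivity

theorem isEnergyKernel_decayKernel : IsEnergyKernel decayKernel := by
  obtain ⟨C, hC⟩ := integral_inv_mul_inv_le
  have hm : Measurable decayKernel := by unfold decayKernel; fun_prop
  refine ⟨⟨hm, 4, 0, by norm_num, integrable_zero _ _ _, fun x => ?_⟩, 4 * C, fun x y hxy => ?_⟩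
  · rw [Real.norm_of_nonneg (decayKernel_nonneg x), decayKernel]
    simp only [Pi.zero_apply, add_zero]
    rw [← div_eq_mul_inv, inv_mul_eq_div, div_le_div_iff₀ (by positivity) (by positivity)]
    nlinarith [sq_nonneg (‖x‖ - 1), sq_nonneg ‖x‖]
  · have e : ∀ z, ‖decayKernel (z - x)‖ * ‖decayKernel (z - y)‖
        = 4 * ((1 + ‖z - x‖ ^ 2)⁻¹ * (1 + ‖z - y‖ ^ 2)⁻¹) := fun z => by
      rw [Real.norm_of_nonneg (decayKernel_nonneg _), Real.norm_of_nonneg (decayKernel_nonneg _),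
        decayKernel, decayKernel]; ring
    simp_rw [e]
    refine ⟨(hC x y).1.const_mul 4, ?_⟩
    have hC0 : 0 ≤ C := by
      have h1 := (hC 0 0).2
      have h2 : 0 ≤ ∫ z : E3, (1 + ‖z - 0‖ ^ 2)⁻¹ * (1 + ‖z - 0‖ ^ 2)⁻¹ :=
        integral_nonneg fun z => by positivity
      simpa using h2.trans h1
    rw [integral_const_mul, mul_assoc]
    gcongr
    refine (hC x y).2.trans ?_
    gcongr
    exact inv_le_profileK (norm_pos_iff.2 (sub_ne_zero.2 hxy))

/-- The potential of `u` for the regularized kernel. -/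
noncomputable def regPotential (ε : ℝ) (u : E3 → ℝ) (x : E3) : ℝ :=
  ∫ y, profileK (regNorm ε (x - y)) * u y

variable {ε : ℝ} {u : E3 → ℝ}

theorem hasFDerivAt_regPotential (hε : 0 < ε) (hu : Integrable u) (x : E3) :
    HasFDerivAt (regPotential ε u) (∫ y, u y • innerSL ℝ
      ((fluxK (regNorm ε (x - y)) / regNorm ε (x - y) ^ 3) • (x - y))) x := by
  have hc := continuous_comp_regNorm hasDerivAt_profileK hε
  have hf := continuous_field_regNorm continuous_fluxK hε
  have hm : ∀ x, AEStronglyMeasurable fun y => profileK (regNorm ε (x - y)) * u y := fun x =>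
    (hc.comp (by fun_prop)).aestronglyMeasurable.mul hu.aestronglyMeasurable
  -- The bound 2‖u‖ comes from |∇K_ε| ≤ 2, uniformly in the position.
  refine hasFDerivAt_integral_of_dominated_of_fderiv_le (s := univ) univ_mem
    (F := fun x y => profileK (regNorm ε (x - y)) * u y)
    (F' := fun x y => u y • innerSL ℝ
      ((fluxK (regNorm ε (x - y)) / regNorm ε (x - y) ^ 3) • (x - y)))
    (bound := fun y => 2 * ‖u y‖) (Eventually.of_forall hm) ?_ ?_ ?_ (hu.norm.const_mul 2) ?_
  · refine hu.norm.mono' (hm x) (ae_of_all _ fun y => ?_)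
    have hs := (regNorm_pos hε (x - y)).le
    rw [norm_mul, Real.norm_of_nonneg (profileK_nonneg hs)]
    exact mul_le_of_le_one_left (norm_nonneg _) (profileK_le_one hs)
  · exact hu.aestronglyMeasurable.smul
      (((innerSL ℝ).continuous.comp (hf.comp (by fun_prop))).aestronglyMeasurable)
  · refine ae_of_all _ fun y x _ => ?_
    rw [norm_smul, innerSL_apply_norm, mul_comm]
    gcongr
    refine (norm_fluxK_smul_le (regNorm_pos hε _).le (norm_le_regNorm _ _)).trans ?_
    rw [← div_eq_mul_inv]
    exact div_le_self (by norm_num) (by nlinarith [sq_nonneg ‖x - y‖])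
  · refine ae_of_all _ fun y x _ => ?_
    have h := (hasGradientAt_comp_regNorm hasDerivAt_profileK hε (x - y)).hasFDerivAt
    have h2 := ((hasFDerivAt_comp_sub y).2 h).mul_const (u y)
    exact h2

theorem contDiff_regPotential (hε : 0 < ε) (hu : Integrable u) :
    ContDiff ℝ 1 (regPotential ε u) := by
  have hf := continuous_field_regNorm continuous_fluxK hε
  rw [contDiff_one_iff_fderiv]
  refine ⟨fun x => (hasFDerivAt_regPotential hε hu x).differentiableAt, ?_⟩
  rw [show fderiv ℝ (regPotential ε u) = _ from
    funext fun x => (hasFDerivAt_regPotential hε hu x).fderiv]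
  refine continuous_of_dominated (bound := fun y => 2 * ‖u y‖) (fun x => ?_) (fun x => ?_)
    (hu.norm.const_mul 2) ?_
  · exact hu.aestronglyMeasurable.smul
      (((innerSL ℝ).continuous.comp (hf.comp (by fun_prop))).aestronglyMeasurable)
  · refine ae_of_all _ fun y => ?_
    rw [norm_smul, innerSL_apply_norm, mul_comm]
    gcongr
    refine (norm_fluxK_smul_le (regNorm_pos hε _).le (norm_le_regNorm _ _)).trans ?_
    rw [← div_eq_mul_inv]
    exact div_le_self (by norm_num) (by nlinarith [sq_nonneg ‖x - y‖])
  · refine ae_of_all _ fun y => ?_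
    have hcont : Continuous fun x : E3 => innerSL ℝ
      ((fluxK (regNorm ε (x - y)) / regNorm ε (x - y) ^ 3) • (x - y)) :=
      (innerSL ℝ).continuous.comp (hf.comp (continuous_sub_right y))
    exact hcont.const_smul (u y)

/-- The bound depends neither on ε nor on u, so it dominates a whole approximating sequence. -/
theorem norm_fderiv_regPotential_le (hε : 0 < ε) (hu : Integrable u) {f : E3 → ℝ}
    (huf : ∀ y, |u y| ≤ f y) {x : E3} (hx : Integrable fun y => f y • decayKernel (x - y)) :
    ‖fderiv ℝ (regPotential ε u) x‖ ≤ conv decayKernel f x := by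
  rw [(hasFDerivAt_regPotential hε hu x).fderiv]
  refine norm_integral_le_of_norm_le hx (ae_of_all _ fun y => ?_)
  rw [norm_smul, innerSL_apply_norm, smul_eq_mul]
  exact mul_le_mul (huf y) (norm_fluxK_smul_le (regNorm_pos hε _).le (norm_le_regNorm _ _))
    (norm_nonneg _) ((abs_nonneg _).trans (huf y))

theorem tendsto_regPotential_cocompact (hε : 0 < ε) (hu : Integrable u) :
    Tendsto (regPotential ε u) (cocompact E3) (𝓝 0) := by
  have hc := continuous_comp_regNorm hasDerivAt_profileK hε
  -- Dominated convergence along a filter needs it to be countably generated.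
  have hcg : (cocompact E3).IsCountablyGenerated := by
    rw [← Metric.cobounded_eq_cocompact, ← comap_norm_atTop]
    infer_instance
  have h := tendsto_integral_filter_of_dominated_convergence (l := cocompact E3)
    (F := fun x y => profileK (regNorm ε (x - y)) * u y) (f := fun _ => (0 : ℝ)) (μ := volume)
    (fun y => ‖u y‖) ?_ ?_ hu.norm ?_
  · rw [integral_zero] at h
    exact h
  · exact Eventually.of_forall fun x =>
      (hc.comp (by fun_prop)).aestronglyMeasurable.mul hu.aestronglyMeasurable
  · refine Eventually.of_forall fun x => ae_of_all _ fun y => ?_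
    have hs := (regNorm_pos hε (x - y)).le
    rw [norm_mul, Real.norm_of_nonneg (profileK_nonneg hs)]
    exact mul_le_of_le_one_left (norm_nonneg _) (profileK_le_one hs)
  · refine ae_of_all _ fun y => ?_
    rw [← zero_mul (u y)]
    refine Tendsto.mul_const _ ?_
    have ht : Tendsto (fun z : E3 => ‖z - y‖) (cocompact E3) atTop :=
      tendsto_norm_cocompact_atTop.comp
        (Homeomorph.subRight y).isClosedEmbedding.tendsto_cocompact
    refine squeeze_zero_norm' (a := fun z => ‖z - y‖⁻¹) ?_ (tendsto_inv_atTop_zero.comp ht)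
    filter_upwards [ht.eventually (eventually_gt_atTop 0)] with z hz
    refine (abs_profileK_le_inv (regNorm_pos hε _).le).trans ?_
    gcongr
    exact norm_le_regNorm _ _

end SmoothedPotential

/-! ### The potential lies in L⁶ -/

section Sobolev

/-- The truncation of `f` in height and space. -/
noncomputable def trunc (f : E3 → ℝ) (n : ℕ) : E3 → ℝ :=
  (Metric.ball (0 : E3) n).indicator fun y => min (f y) n

variable {f : E3 → ℝ}

theorem trunc_nonneg {n : ℕ} {y : E3} (hf : 0 ≤ f y) : 0 ≤ trunc f n y := by
  unfold trunc indicator; split_ifs <;> simp [hf]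

theorem trunc_le {n : ℕ} {y : E3} (hf : 0 ≤ f y) : trunc f n y ≤ f y := by
  unfold trunc indicator; split_ifs <;> simp [hf]

theorem trunc_le_nat {n : ℕ} {y : E3} : trunc f n y ≤ n := by
  unfold trunc indicator; split_ifs <;> simp

theorem trunc_eq_zero {n : ℕ} {y : E3} (hy : (n : ℝ) ≤ ‖y‖) : trunc f n y = 0 :=
  indicator_of_notMem (by simpa using hy) _

theorem eventually_trunc_eq (f : E3 → ℝ) (y : E3) : ∀ᶠ n in atTop, trunc f n y = f y := by
  filter_upwards [tendsto_natCast_atTop_atTop.eventually_gt_atTop ‖y‖,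
    tendsto_natCast_atTop_atTop.eventually_ge_atTop (f y)] with n h1 h2
  rw [trunc, indicator_of_mem (by simpa using h1), min_eq_left h2]

theorem aestronglyMeasurable_trunc (hf : AEStronglyMeasurable f) (n : ℕ) :
    AEStronglyMeasurable (trunc f n) :=
  (hf.inf aestronglyMeasurable_const).indicator measurableSet_ball

theorem integrable_trunc (hf : IsAdmissible f) (hf0 : 0 ≤ᵐ[volume] f) (n : ℕ) :
    Integrable (trunc f n) := by
  have h : IntegrableOn f (Metric.ball 0 n) :=
    (hf.locallyIntegrable.integrableOn_isCompact (isCompact_closedBall 0 n)).mono_set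
      Metric.ball_subset_closedBall
  refine (h.integrable_indicator measurableSet_ball).mono'
    (aestronglyMeasurable_trunc hf.aestronglyMeasurable n) ?_
  filter_upwards [hf0] with y hy
  by_cases hb : y ∈ Metric.ball (0 : E3) n
  · rw [Real.norm_of_nonneg (trunc_nonneg hy), indicator_of_mem hb]; exact trunc_le hy
  · simp [trunc, indicator_of_notMem hb]

theorem tendsto_regPotential_trunc (hf : IsAdmissible f) (hf0 : ∀ y, 0 ≤ f y) {ε : ℕ → ℝ}
    (hε : ∀ n, 0 < ε n) (hε0 : Tendsto ε atTop (𝓝 0)) (x : E3) :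
    Tendsto (fun n => regPotential (ε n) (trunc f n) x) atTop (𝓝 (potential f x)) := by
  refine tendsto_integral_of_dominated_convergence
    (fun y => 2 * (1 + ‖x‖) * ((1 + ‖y‖)⁻¹ * f y)) (fun n => ?_)
    (Integrable.const_mul hf _) (fun n => ae_of_all _ fun y => ?_) ?_
  · exact ((continuous_comp_regNorm hasDerivAt_profileK (hε n)).comp
      (by fun_prop)).aestronglyMeasurable.mul
      (aestronglyMeasurable_trunc hf.aestronglyMeasurable n)
  · have hs := (regNorm_pos (hε n) (x - y)).le
    rw [norm_mul, Real.norm_of_nonneg (profileK_nonneg hs),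
      Real.norm_of_nonneg (trunc_nonneg (hf0 y)), ← mul_assoc]
    gcongr
    · exact trunc_nonneg (hf0 y)
    · refine (profileK_le hs).trans ?_
      rw [mul_assoc]
      gcongr
      refine le_trans ?_ (inv_one_add_norm_sub_le x y)
      gcongr
      exact norm_le_regNorm _ _
    · exact trunc_le (hf0 y)
  · filter_upwards [(by simp [ae_iff] : ∀ᵐ y : E3, y ≠ x)] with y hy
    refine Tendsto.mul ?_ ?_
    · exact tendsto_comp_regNorm hasDerivAt_profileK (sub_ne_zero.2 hy.symm) hε0
    · exact tendsto_const_nhds.congr' ((eventually_trunc_eq f y).mono fun n hn => hn.symm)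

theorem exists_sobolev_const : ∃ C : ℝ≥0∞, C < ⊤ ∧ ∀ v : E3 → ℝ, ContDiff ℝ 1 v →
    HasCompactSupport v → eLpNorm v 6 ≤ C * eLpNorm (fderiv ℝ v) 2 := by
  refine ⟨SNormLESNormFDerivOfEqConst ℝ (volume : Measure E3) (2 : NNReal), ENNReal.coe_lt_top,
    fun v hv1 hv2 => ?_⟩
  have h1 := eLpNorm_le_eLpNorm_fderiv_of_eq (volume : Measure E3) hv1 hv2
    (p := 2) (p' := 6) (by norm_num) (by simp) (by simp; norm_num)
  rwa [ENNReal.coe_ofNat, ENNReal.coe_ofNat] at h1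

/-- The Sobolev inequality is available for compactly supported C¹ functions, hence the
approximants: truncate f, regularize K, then cut off small values. Their gradients lie below the
convolution of f with `decayKernel`, which is in L² because that kernel obeys the same energy bound
as ∇K. -/
theorem memLp_six_potential_of_nonneg (hf : IsAdmissible f) (hf0 : ∀ y, 0 ≤ f y)
    (h : FiniteEnergy f f) : MemLp (potential f) 6 := by
  obtain ⟨ε, hε, hε0⟩ := exists_regularization
  have hm := isEnergyKernel_decayKernel.memLp_conv hf h
  set v : ℕ → E3 → ℝ := fun n x => softThreshold (ε n) (regPotential (ε n) (trunc f n) x)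
  have hui := fun n => integrable_trunc hf (ae_of_all _ hf0) n
  have hv1 : ∀ n, ContDiff ℝ 1 (v n) := fun n =>
    (contDiff_softThreshold (hε n)).comp (contDiff_regPotential (hε n) (hui n))
  have hv2 : ∀ n, HasCompactSupport (v n) := fun n => by
    rw [hasCompactSupport_iff_eventuallyEq, coclosedCompact_eq_cocompact]
    filter_upwards [(tendsto_regPotential_cocompact (hε n) (hui n)).eventually
      (gt_mem_nhds (hε n))] with x hx
    exact softThreshold_eq_zero (hε n) hx.le
  have hv3 : ∀ n, ∀ᵐ x, ‖fderiv ℝ (v n) x‖ ≤ conv decayKernel f x := fun n => by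
    filter_upwards [isEnergyKernel_decayKernel.1.ae_integrable hf] with x hx
    have hd := (hasDerivAt_softThreshold (hε n) (regPotential (ε n) (trunc f n) x)).comp_hasFDerivAt
      x (hasFDerivAt_regPotential (hε n) (hui n) x)
    have hd1 := abs_deriv_softThreshold_le (hε n) (regPotential (ε n) (trunc f n) x)
    rw [(hasDerivAt_softThreshold (hε n) _).deriv] at hd1
    have hb := norm_fderiv_regPotential_le (hε n) (hui n) (f := f)
      (fun y => by rw [abs_of_nonneg (trunc_nonneg (hf0 y))]; exact trunc_le (hf0 y)) hx
    rw [(hasFDerivAt_regPotential (hε n) (hui n) x).fderiv] at hb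
    rw [show fderiv ℝ (v n) x = _ from hd.fderiv, norm_smul]
    exact (mul_le_of_le_one_left (norm_nonneg _) hd1).trans hb
  obtain ⟨C, hC, hCS⟩ := exists_sobolev_const
  have hS : ∀ n, eLpNorm (v n) 6 volume ≤ C * eLpNorm (conv decayKernel f) 2 := fun n =>
    (hCS _ (hv1 n) (hv2 n)).trans (mul_le_mul_right (eLpNorm_mono_ae_real (hv3 n)) _)
  have hlim : ∀ᵐ x, Tendsto (fun n => v n x) atTop (𝓝 (potential f x)) := ae_of_all _ fun x =>
    tendsto_softThreshold hε0 (tendsto_regPotential_trunc hf hf0 hε hε0 x)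
      (integral_nonneg fun y => mul_nonneg (kernel_nonneg _) (hf0 y))
  refine ⟨?_, ?_⟩
  · rw [potential_eq_conv]
    exact (isMildKernel_kernel.locallyIntegrable_conv hf).aestronglyMeasurable
  · refine (Lp.eLpNorm_lim_le_liminf_eLpNorm
      (fun n => (hv1 n).continuous.aestronglyMeasurable) _ hlim).trans_lt ?_
    exact ((liminf_le_liminf (Eventually.of_forall hS)).trans (liminf_const _).le).trans_lt
      (ENNReal.mul_lt_top hC hm.2)

theorem IsAdmissible.abs (hf : IsAdmissible f) : IsAdmissible fun x => |f x| := by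
  refine (Integrable.norm hf).congr (ae_of_all _ fun y => ?_)
  have hy0 : (0 : ℝ) ≤ (1 + ‖y‖)⁻¹ := by positivity
  simp only [norm_mul, Real.norm_of_nonneg hy0, Real.norm_eq_abs]

/-- Reduces to the nonnegative case by |ψ_f| ≤ ψ_{|f|}. -/
theorem memLp_six_potential (hf : IsAdmissible f) (h : FiniteEnergy f f) :
    MemLp (potential f) 6 := by
  have ha := hf.abs
  have h2 : FiniteEnergy (fun x => |f x|) (fun x => |f x|) :=
    h.mono ha.aestronglyMeasurable ha.aestronglyMeasurable (by simp) (by simp)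
  refine (memLp_six_potential_of_nonneg ha (fun y => abs_nonneg _) h2).mono ?_
    (ae_of_all _ fun x => ?_)
  · rw [potential_eq_conv]
    exact (isMildKernel_kernel.locallyIntegrable_conv hf).aestronglyMeasurable
  · refine le_trans ?_ (Real.le_norm_self _)
    refine norm_integral_le_of_norm_le (ha.integrable_kernel x) (ae_of_all _ fun y => ?_)
    rw [norm_mul, Real.norm_of_nonneg (kernel_nonneg _), Real.norm_eq_abs]

end Sobolev

/-! ### Equivalence of finite energy and membership in 𝒜 -/

section Main

variable {f : E3 → ℝ}

theorem HasWeakGradient.weakGradient_ae_eq {u : E3 → ℝ} {G : E3 → E3} (h : HasWeakGradient u G) :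
    weakGradient u =ᵐ[volume] G := by
  have hex : ∃ G, HasWeakGradient u G := ⟨G, h⟩
  rw [weakGradient, dif_pos hex]
  exact hex.choose_spec.ae_eq h

theorem HasWeakLaplacian.weakLaplacian_ae_eq {u L : E3 → ℝ} (h : HasWeakLaplacian u L) :
    weakLaplacian u =ᵐ[volume] L := by
  have hex : ∃ L, HasWeakLaplacian u L := ⟨L, h⟩
  rw [weakLaplacian, dif_pos hex]
  exact hex.choose_spec.ae_eq h

theorem FiniteEnergy.potentialInA (hf : AEMeasurable f) (h : FiniteEnergy f f) :
    PotentialInA f := by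
  have ha := h.isAdmissible hf.aestronglyMeasurable
  exact ⟨ae_of_all _ ha.integrable_kernel, ⟨memLp_six_potential ha h, _, ha.hasWeakGradient,
    isEnergyKernel_gradK.memLp_conv ha h⟩, _, ha.hasWeakLaplacian,
    (isEnergyKernel_yukawa.memLp_conv ha h).neg⟩

theorem FiniteEnergy.isWeakSolution (hf : AEMeasurable f) (h : FiniteEnergy f f) :
    IsWeakSolution f (potential f) := by
  have ha := h.isAdmissible hf.aestronglyMeasurable
  refine ⟨(h.potentialInA hf).2, ha.locallyIntegrable, fun φ hφ => ?_⟩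
  rw [← ha.weak_equation hφ]
  refine integral_congr_ae ?_
  filter_upwards [ha.hasWeakGradient.weakGradient_ae_eq,
    ha.hasWeakLaplacian.weakLaplacian_ae_eq] with x h1 h2
  rw [h1, h2, Pi.neg_apply]

theorem FiniteEnergy.integrable_conv_sq (ha : IsAdmissible f) (h : FiniteEnergy f f) :
    Integrable (fun x => ‖conv gradK f x‖ ^ 2 + conv yukawa f x ^ 2) ∧
    ∫ x, (‖conv gradK f x‖ ^ 2 + conv yukawa f x ^ 2)
      = 4 * Real.pi * ∫ q : E3 × E3, kernel (q.1 - q.2) * (f q.1 * f q.2)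
        ∂(volume.prod volume) := by
  have i1 : Integrable fun x => ‖conv gradK f x‖ ^ 2 :=
    (isEnergyKernel_gradK.memLp_conv ha h).norm.integrable_sq
  have i2 : Integrable fun x => conv yukawa f x ^ 2 :=
    (isEnergyKernel_yukawa.memLp_conv ha h).integrable_sq
  refine ⟨i1.add i2, ?_⟩
  rw [integral_add i1 i2, ← integral_conv_eq_energy ha ha h]
  simp only [real_inner_self_eq_norm_sq, sq]

theorem FiniteEnergy.energyIdentity (hf : AEMeasurable f) (h : FiniteEnergy f f) :
    EnergyIdentity f := by
  have ha := h.isAdmissible hf.aestronglyMeasurable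
  have hae : (fun x => ‖weakGradient (potential f) x‖ ^ 2 + weakLaplacian (potential f) x ^ 2)
      =ᵐ[volume] fun x => ‖conv gradK f x‖ ^ 2 + conv yukawa f x ^ 2 := by
    filter_upwards [ha.hasWeakGradient.weakGradient_ae_eq,
      ha.hasWeakLaplacian.weakLaplacian_ae_eq] with x h1 h2
    rw [h1, h2, Pi.neg_apply, neg_sq]
  obtain ⟨i1, i2⟩ := h.integrable_conv_sq ha
  obtain ⟨k1, k2⟩ := h.integrable_mul
  refine ⟨i1.congr hae.symm, ?_, ?_⟩
  · simpa only [mul_comm] using k1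
  · rw [integral_congr_ae hae, i2, ← k2]
    simp only [mul_comm (potential f _)]

/-- Truncating one factor is enough: it serves as the bounded, boundedly supported weight, and the
other need only be admissible. -/
theorem finiteEnergy_trunc_left {g : E3 → ℝ} (hf : IsAdmissible f) (hf0 : ∀ y, 0 ≤ f y)
    (hg : IsAdmissible g) (n : ℕ) : FiniteEnergy (trunc f n) g := by
  have h := isMildKernel_kernel.integrable_prod hg
    (aestronglyMeasurable_trunc hf.aestronglyMeasurable n) (C := n) (R := n)
    (fun z => by rw [abs_of_nonneg (trunc_nonneg (hf0 z))]; exact trunc_le_nat)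
    (fun z hz => trunc_eq_zero hz)
  simpa only [FiniteEnergy, smul_eq_mul, mul_comm] using h

/-- If `ψ_f ∈ 𝒜` then the truncations of `f` have bounded energy, hence `f` has finite energy. -/
theorem PotentialInA.finiteEnergy (hf : AEMeasurable f) (hf0 : ∀ y, 0 ≤ f y)
    (h : PotentialInA f) : FiniteEnergy f f := by
  obtain ⟨x₀, hx₀⟩ := h.1.exists
  have ha : IsAdmissible f := isAdmissible_of_integrable_kernel hf.aestronglyMeasurable hx₀
  obtain ⟨-, ⟨-, G, hG, hG2⟩, L, hL, hL2⟩ := h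
  have hGa : MemLp (conv gradK f) 2 := (memLp_congr_ae (hG.ae_eq ha.hasWeakGradient)).1 hG2
  have hLa : MemLp (conv yukawa f) 2 := by
    have := ((memLp_congr_ae (hL.ae_eq ha.hasWeakLaplacian)).1 hL2).neg
    rwa [neg_neg] at this
  have j1 : Integrable fun x => ‖conv gradK f x‖ ^ 2 := hGa.norm.integrable_sq
  have j2 : Integrable fun x => conv yukawa f x ^ 2 := hLa.integrable_sq
  have j12 : Integrable fun x => ‖conv gradK f x‖ ^ 2 + conv yukawa f x ^ 2 := j1.add j2
  set A : ℝ := ∫ x, (‖conv gradK f x‖ ^ 2 + conv yukawa f x ^ 2) with hA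
  have hta : ∀ n, IsAdmissible (trunc f n) := fun n => by
    refine Integrable.mono ha ((by fun_prop : Measurable fun y : E3 =>
      (1 + ‖y‖)⁻¹).aestronglyMeasurable.mul
        (aestronglyMeasurable_trunc hf.aestronglyMeasurable n)) (ae_of_all _ fun y => ?_)
    rw [norm_mul, norm_mul, Real.norm_of_nonneg (trunc_nonneg (hf0 y)),
      Real.norm_of_nonneg (hf0 y)]
    gcongr
    exact trunc_le (hf0 y)
  have hFn : ∀ n, FiniteEnergy (trunc f n) (trunc f n) := fun n =>
    finiteEnergy_trunc_left ha hf0 (hta n) n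
  have hFf : ∀ n, FiniteEnergy (trunc f n) f := fun n => finiteEnergy_trunc_left ha hf0 ha n
  have hbound : ∀ n, 4 * Real.pi * ∫ q : E3 × E3, kernel (q.1 - q.2) *
      (trunc f n q.1 * trunc f n q.2) ∂(volume.prod volume) ≤ A := by
    intro n
    obtain ⟨i1, i2⟩ := (hFn n).integrable_conv_sq (hta n)
    -- Here f ≥ 0 is essential: enlarging one factor from f_n to f can only increase the energy.
    have hmono : ∫ q : E3 × E3, kernel (q.1 - q.2) * (trunc f n q.1 * trunc f n q.2)
        ∂(volume.prod volume) ≤ ∫ q : E3 × E3, kernel (q.1 - q.2) * (trunc f n q.1 * f q.2)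
        ∂(volume.prod volume) := by
      refine integral_mono (hFn n) (hFf n) fun q => ?_
      exact mul_le_mul_of_nonneg_left (mul_le_mul_of_nonneg_left (trunc_le (hf0 _))
        (trunc_nonneg (hf0 _))) (kernel_nonneg _)
    have hpol := integral_conv_eq_energy (hta n) ha (hFf n)
    have m1 := (isEnergyKernel_gradK.integral_inner_conv (hta n) ha (hFf n)).1
    have m2 := (isEnergyKernel_yukawa.integral_inner_conv (hta n) ha (hFf n)).1
    have e : ∀ a b : ℝ, inner ℝ a b = a * b := fun a b => by simp [mul_comm]
    simp_rw [e] at m2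
    rw [← integral_add m1 m2] at hpol
    -- Young's inequality with weights ½, so that half of the finite energy of f_n can be absorbed
    -- on the left.
    have hle : ∫ x, (inner ℝ (conv gradK (trunc f n) x) (conv gradK f x)
        + conv yukawa (trunc f n) x * conv yukawa f x)
        ≤ ∫ x, (1 / 2 * (‖conv gradK (trunc f n) x‖ ^ 2 + conv yukawa (trunc f n) x ^ 2)
          + 1 / 2 * (‖conv gradK f x‖ ^ 2 + conv yukawa f x ^ 2)) := by
      refine integral_mono (m1.add m2) ((i1.const_mul _).add (j12.const_mul _)) fun x => ?_
      have h1 := real_inner_le_norm (conv gradK (trunc f n) x) (conv gradK f x)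
      simp only
      nlinarith [sq_nonneg (‖conv gradK (trunc f n) x‖ - ‖conv gradK f x‖),
        sq_nonneg (conv yukawa (trunc f n) x - conv yukawa f x)]
    rw [integral_add (i1.const_mul _) (j12.const_mul _), integral_const_mul,
      integral_const_mul, i2, ← hA, hpol] at hle
    have h4 : 0 < 4 * Real.pi := by positivity
    have h5 := mul_le_mul_of_nonneg_left hmono h4.le
    linarith
  refine ⟨aestronglyMeasurable_kernel_mul hf.aestronglyMeasurable hf.aestronglyMeasurable, ?_⟩
  -- At each point the truncations eventually equal f, so Fatou's lemma carries the uniform bound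
  -- over to f.
  have hlim : ∀ q : E3 × E3, ‖kernel (q.1 - q.2) * (f q.1 * f q.2)‖ₑ
      ≤ liminf (fun n => ‖kernel (q.1 - q.2) * (trunc f n q.1 * trunc f n q.2)‖ₑ) atTop := by
    intro q
    refine le_of_eq (Tendsto.liminf_eq ?_).symm
    refine tendsto_const_nhds.congr' ?_
    filter_upwards [eventually_trunc_eq f q.1, eventually_trunc_eq f q.2] with n h1 h2
    rw [h1, h2]
  have hn : ∀ n, ∫⁻ q : E3 × E3, ‖kernel (q.1 - q.2) * (trunc f n q.1 * trunc f n q.2)‖ₑ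
      ∂(volume.prod volume) ≤ ENNReal.ofReal (A / (4 * Real.pi)) := by
    intro n
    have hnn : ∀ q : E3 × E3, 0 ≤ kernel (q.1 - q.2) * (trunc f n q.1 * trunc f n q.2) := fun q =>
      mul_nonneg (kernel_nonneg _) (mul_nonneg (trunc_nonneg (hf0 _)) (trunc_nonneg (hf0 _)))
    rw [← ofReal_integral_norm_eq_lintegral_enorm (hFn n)]
    simp_rw [Real.norm_of_nonneg (hnn _)]
    refine ENNReal.ofReal_le_ofReal ?_
    rw [le_div_iff₀ (by positivity), mul_comm]
    exact hbound n
  calc _ ≤ ∫⁻ q : E3 × E3, liminf (fun n =>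
        ‖kernel (q.1 - q.2) * (trunc f n q.1 * trunc f n q.2)‖ₑ) atTop ∂(volume.prod volume) :=
        lintegral_mono hlim
    _ ≤ liminf (fun n => ∫⁻ q : E3 × E3,
        ‖kernel (q.1 - q.2) * (trunc f n q.1 * trunc f n q.2)‖ₑ ∂(volume.prod volume)) atTop :=
        lintegral_liminf_le' fun n => (hFn n).1.enorm
    _ ≤ ENNReal.ofReal (A / (4 * Real.pi)) :=
        (liminf_le_liminf (Eventually.of_forall hn)).trans (liminf_const _).le
    _ < ⊤ := ENNReal.ofReal_lt_top

theorem potential_congr {g : E3 → ℝ} (h : f =ᵐ[volume] g) : potential f = potential g := by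
  ext x
  refine integral_congr_ae ?_
  filter_upwards [h] with y hy
  rw [hy]

theorem PotentialInA.congr {g : E3 → ℝ} (hf : PotentialInA f) (h : f =ᵐ[volume] g) :
    PotentialInA g := by
  refine ⟨?_, potential_congr h ▸ hf.2⟩
  filter_upwards [hf.1] with x hx
  refine hx.congr ?_
  filter_upwards [h] with y hy
  rw [hy]

theorem HasWeakGradient.add {u v : E3 → ℝ} {G H : E3 → E3} (hu : HasWeakGradient u G)
    (hv : HasWeakGradient v H) : HasWeakGradient (u + v) (G + H) := by
  refine ⟨hu.1.add hv.1, hu.2.1.add hv.2.1, fun φ hφ => ?_⟩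
  simp only [Pi.add_apply, add_smul, smul_add]
  rw [integral_add, integral_add, hu.2.2 φ hφ, hv.2.2 φ hφ, neg_add]
  · exact hu.2.1.integrable_smul_left_of_hasCompactSupport hφ.1.continuous hφ.2
  · exact hv.2.1.integrable_smul_left_of_hasCompactSupport hφ.1.continuous hφ.2
  · exact hu.1.integrable_smul_right_of_hasCompactSupport hφ.continuous_gradient
      hφ.hasCompactSupport_gradient
  · exact hv.1.integrable_smul_right_of_hasCompactSupport hφ.continuous_gradient
      hφ.hasCompactSupport_gradient

theorem HasWeakLaplacian.add {u v L M : E3 → ℝ} (hu : HasWeakLaplacian u L)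
    (hv : HasWeakLaplacian v M) : HasWeakLaplacian (u + v) (L + M) := by
  refine ⟨hu.1.add hv.1, hu.2.1.add hv.2.1, fun φ hφ => ?_⟩
  simp only [Pi.add_apply, add_mul, mul_add]
  rw [integral_add, integral_add, hu.2.2 φ hφ, hv.2.2 φ hφ]
  · exact hu.2.1.integrable_smul_left_of_hasCompactSupport hφ.1.continuous hφ.2
  · exact hv.2.1.integrable_smul_left_of_hasCompactSupport hφ.1.continuous hφ.2
  · exact hu.1.integrable_smul_right_of_hasCompactSupport hφ.continuous_laplacian
      hφ.hasCompactSupport_laplacian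
  · exact hv.1.integrable_smul_right_of_hasCompactSupport hφ.continuous_laplacian
      hφ.hasCompactSupport_laplacian

theorem add_mem_spaceA {u v : E3 → ℝ} (hu : u ∈ spaceA) (hv : v ∈ spaceA) : u + v ∈ spaceA := by
  obtain ⟨⟨hu6, G, hG, hG2⟩, L, hL, hL2⟩ := hu
  obtain ⟨⟨hv6, H, hH, hH2⟩, M, hM, hM2⟩ := hv
  exact ⟨⟨hu6.add hv6, _, hG.add hH, hG2.add hH2⟩, _, hL.add hM, hL2.add hM2⟩

theorem PotentialInA.add {g : E3 → ℝ} (hfm : AEMeasurable f) (hgm : AEMeasurable g)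
    (hf : PotentialInA f) (hg : PotentialInA g) : PotentialInA (f + g) := by
  obtain ⟨x, hx⟩ := hf.1.exists
  obtain ⟨y, hy⟩ := hg.1.exists
  have hfa := isAdmissible_of_integrable_kernel hfm.aestronglyMeasurable hx
  have hga := isAdmissible_of_integrable_kernel hgm.aestronglyMeasurable hy
  refine ⟨ae_of_all _ fun x => ?_, ?_⟩
  · simp only [Pi.add_apply, mul_add]
    exact (hfa.integrable_kernel x).add (hga.integrable_kernel x)
  · have e : potential (f + g) = potential f + potential g := by
      ext x
      simp only [potential, Pi.add_apply, mul_add]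
      exact integral_add (hfa.integrable_kernel x) (hga.integrable_kernel x)
    rw [e]
    exact add_mem_spaceA hf.2 hg.2

theorem mem_E1_iff : f ∈ E1 ↔ AEMeasurable f ∧ FiniteEnergy f f :=
  and_congr_right fun hf => energy_abs_lt_top_iff hf hf

theorem mem_E1plus_iff : f ∈ E1plus ↔ AEMeasurable f ∧ 0 ≤ᵐ[volume] f ∧ FiniteEnergy f f := by
  refine and_congr_right fun hf => and_congr_right fun hf0 => ?_
  rw [← energy_abs_lt_top_iff hf hf]
  have e : (fun x => ENNReal.ofReal (f x)) =ᵐ[volume] fun x => ENNReal.ofReal |f x| := by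
    filter_upwards [hf0] with x hx
    rw [abs_of_nonneg hx]
  have : energy (fun x => ENNReal.ofReal (f x)) (fun x => ENNReal.ofReal (f x))
      = energy (fun x => ENNReal.ofReal |f x|) (fun x => ENNReal.ofReal |f x|) := by
    refine lintegral_congr_ae ?_
    filter_upwards [e] with x hx
    refine lintegral_congr_ae ?_
    filter_upwards [e] with y hy
    rw [hx, hy]
  rw [this]

theorem E1plus_eq_E2plus : E1plus = E2plus := by
  ext f
  rw [mem_E1plus_iff]
  refine and_congr_right fun hf => and_congr_right fun hf0 => ⟨fun h => h.potentialInA hf,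
    fun h => ?_⟩
  -- Passes to a representative that is nonnegative everywhere, as the converse direction requires.
  have e : f =ᵐ[volume] fun x => max (f x) 0 := by
    filter_upwards [hf0] with x hx
    exact (max_eq_left hx).symm
  have hm : AEMeasurable fun x => max (f x) 0 := hf.max aemeasurable_const
  have h1 := (h.congr e).finiteEnergy hm fun x => le_max_right _ _
  refine h1.mono hf.aestronglyMeasurable hf.aestronglyMeasurable ?_ ?_ <;>
  · filter_upwards [e] with x hx
    rw [← hx]

theorem E1_eq_E2 : E1 = E2 := by
  ext f
  rw [mem_E1_iff]
  refine and_congr_right fun hf => ?_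
  have hp : AEMeasurable fun x => max (f x) 0 := hf.max aemeasurable_const
  have hn : AEMeasurable fun x => max (-f x) 0 := hf.neg.max aemeasurable_const
  refine ⟨fun h => ⟨?_, ?_⟩, fun ⟨h1, h2⟩ => ?_⟩
  · have hle : ∀ᵐ x, |max (f x) 0| ≤ |f x| := ae_of_all _ fun x => by
      rw [abs_of_nonneg (le_max_right _ _)]
      exact max_le (le_abs_self _) (abs_nonneg _)
    exact (h.mono hp.aestronglyMeasurable hp.aestronglyMeasurable hle hle).potentialInA hp
  · have hle : ∀ᵐ x, |max (-f x) 0| ≤ |f x| := ae_of_all _ fun x => by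
      rw [abs_of_nonneg (le_max_right _ _)]
      exact max_le (neg_le_abs _) (abs_nonneg _)
    exact (h.mono hn.aestronglyMeasurable hn.aestronglyMeasurable hle hle).potentialInA hn
  -- The nonnegative case is applied to f⁺ + f⁻ = |f|, which also bounds the mixed energy of f⁺ and
  -- f⁻.
  · have h3 := (h1.add hp hn h2).finiteEnergy (hp.add hn)
      fun x => add_nonneg (le_max_right _ _) (le_max_right _ _)
    have hle : ∀ᵐ x, |f x| ≤ |((fun x => max (f x) 0) + fun x => max (-f x) 0) x| :=
      ae_of_all _ fun x => by
        refine le_trans ?_ (le_abs_self _)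
        simp only [Pi.add_apply]
        rcases le_total 0 (f x) with h | h
        · rw [abs_of_nonneg h, max_eq_left h]
          linarith [le_max_right (-f x) 0]
        · rw [abs_of_nonpos h, max_eq_left (neg_nonneg.2 h)]
          linarith [le_max_right (f x) 0]
    exact h3.mono hf.aestronglyMeasurable hf.aestronglyMeasurable hle hle

end Main

end BoppPodolsky

theorem mainTheorem6 :
    (BoppPodolsky.E1plus = BoppPodolsky.E2plus ∧
      ∀ f ∈ BoppPodolsky.E2plus,
        BoppPodolsky.IsWeakSolution f (BoppPodolsky.potential f) ∧
        BoppPodolsky.EnergyIdentity f) ∧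
    (BoppPodolsky.E1 = BoppPodolsky.E2 ∧
      ∀ f ∈ BoppPodolsky.E2,
        BoppPodolsky.PotentialInA f ∧
        BoppPodolsky.IsWeakSolution f (BoppPodolsky.potential f) ∧
        BoppPodolsky.EnergyIdentity f) := by
  refine ⟨⟨BoppPodolsky.E1plus_eq_E2plus, fun f hf => ?_⟩, BoppPodolsky.E1_eq_E2, fun f hf => ?_⟩
  · rw [← BoppPodolsky.E1plus_eq_E2plus, BoppPodolsky.mem_E1plus_iff] at hf
    exact ⟨hf.2.2.isWeakSolution hf.1, hf.2.2.energyIdentity hf.1⟩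
  · rw [← BoppPodolsky.E1_eq_E2, BoppPodolsky.mem_E1_iff] at hf
    exact ⟨hf.2.potentialInA hf.1, hf.2.isWeakSolution hf.1, hf.2.energyIdentity hf.1⟩
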